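/- Let $A,B,C$ be independent random points in $\mathbb{R}^2$, each Gaussian with mean vector zero and identity covariance matrix. The triangle $ABC$ is said to capture a fixed location $(\xi,\eta)\in\mathbb{R}^2$ if $(\xi,\eta)$ is contained in the convex hull of $A,B,C$. Write $P(\xi,\eta)$ for the probability of this event. For $\xi\in\mathbb{R}$ put $$\varphi(\xi)=\int_0^\infty\!\int_0^\infty\!\int_{-\infty}^0 \exp\!\left(-\tfrac{(a_1+\xi)^2+(b_1+\xi)^2+(c_1+\xi)^2}{2}\right)\left[\pi+2\arctan\!\left(\tfrac{a_1b_1}{c_1\sqrt{a_1^2+b_1^2+c_1^2}}\right)\right]dc_1\,db_1\,da_1,$$ $$\psi(\xi)=\int_{-\infty}^0\!\int_{-\infty}^0\!\int_0^\infty \exp\!\left(-\tfrac{(a_1+\xi)^2+(b_1+\xi)^2+(c_1+\xi)^2}{2}\right)\left[\pi-2\arctan\!\left(\tfrac{a_1b_1}{c_1\sqrt{a_1^2+b_1^2+c_1^2}}\right)\right]dc_1\,db_1\,da_1.$$ Then both integrals converge absolutely for every $\xi\in\mathbb{R}$; for all $\xi,\eta\in\mathbb{R}$, $$P(\xi,\eta)=P\!\left(\sqrt{\xi^2+\eta^2},\,0\right);$$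 and for every $\xi\in\mathbb{R}$, $$P(\xi,0)=\frac{3}{(2\pi)^{5/2}}\,\bigl[\varphi(\xi)+\psi(\xi)\bigr].$$ In particular $P(0,0)=\tfrac14$. Moreover, to six decimal places (truncated), $P(\tfrac12,0)=0.197171\ldots$, $P(1,0)=0.098289\ldots$, $P(\tfrac32,0)=0.032455\ldots$ and $P(2,0)=0.007626\ldots$; that is, each of these values lies in the interval $[d,\,d+10^{-6})$, where $d$ is the displayed decimal. -/

import Mathlib

open MeasureTheory ProbabilityTheory Set

namespace GaussianCapture

noncomputable section

/-- The Euclidean plane `ℝ²`. -/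
abbrev Plane : Type := EuclideanSpace ℝ (Fin 2)

/-- The triangle `ABC` captures the location `X`: the point `X` is contained in the convex hull
of `A`, `B`, `C`. -/
def Captures (A B C X : Plane) : Prop :=
  X ∈ convexHull ℝ ({A, B, C} : Set Plane)

/-- The probability that the random triangle `ABC` captures the fixed location `(ξ, η)`. -/
def captureProb {Ω : Type*} [MeasurableSpace Ω] (μ : Measure Ω) (A B C : Ω → Plane)
    (ξ η : ℝ) : ℝ :=
  μ.real {ω | Captures (A ω) (B ω) (C ω) !₂[ξ, η]}

/-- The Gaussian weight `exp (-((a + ξ)² + (b + ξ)² + (c + ξ)²) / 2)`. -/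
def weight (ξ a b c : ℝ) : ℝ :=
  Real.exp (-((a + ξ) ^ 2 + (b + ξ) ^ 2 + (c + ξ) ^ 2) / 2)

/-- The angle `arctan (a b / (c √(a² + b² + c²)))`. -/
def angle (a b c : ℝ) : ℝ :=
  Real.arctan (a * b / (c * Real.sqrt (a ^ 2 + b ^ 2 + c ^ 2)))

/-- The integrand of `φ`. -/
def phiIntegrand (ξ a b c : ℝ) : ℝ :=
  weight ξ a b c * (Real.pi + 2 * angle a b c)

/-- The integrand of `ψ`. -/
def psiIntegrand (ξ a b c : ℝ) : ℝ :=
  weight ξ a b c * (Real.pi - 2 * angle a b c)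

/-- `φ(ξ)`, an iterated integral over `a > 0`, `b > 0`, `c < 0`. -/
def phi (ξ : ℝ) : ℝ :=
  ∫ a in Ioi (0 : ℝ), ∫ b in Ioi (0 : ℝ), ∫ c in Iio (0 : ℝ), phiIntegrand ξ a b c

/-- `ψ(ξ)`, an iterated integral over `a < 0`, `b < 0`, `c > 0`. -/
def psi (ξ : ℝ) : ℝ :=
  ∫ a in Iio (0 : ℝ), ∫ b in Iio (0 : ℝ), ∫ c in Ioi (0 : ℝ), psiIntegrand ξ a b c

end

end GaussianCapture

/-!
Seen from a location `X`, a triangle with vertices `a`, `b`, `c` in general position contains `X`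
exactly when the determinants `cross a b`, `cross b c`, `cross c a` have the same sign
(`captures_iff_mem_cyclicTriples`). Hence the capture probability at `(ξ, 0)` is the probability of
`cyclicTriples` for three independent normal vectors with mean `(-ξ, 0)`. A reflection of the plane
moves a general location to the first axis.

The integral formula comes from the first coordinates. A triangle containing the origin has vertices
on both sides of the second axis, and by cyclic symmetry the isolated one may be taken to be the
last, at the price of a factor `3`. Given the first coordinates, the origin is captured when the two
edges at the last vertex meet the axis on opposite sides of it, and the probability of this
is given by Sheppard's formula `integral_gaussInt_mul_gaussInt` for
`E [(Φ(αz) - 1/2) (Φ(βz) - 1/2)]`, which is proved by differentiation in `α`.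

The integral formula is not suited to numerical evaluation, and the values are found from the
complementary event. A triangle missing the origin has exactly one vertex with the other two on its
left, and given this vertex these two lie there independently. This gives
`P(ξ, 0) = 1 - 3 E [Φ(D)²] = 1/4 - 3 E [(Φ(D) - 1/2)²]`, where `D = sideDist ξ p` is the signed
distance of the mean to the line through the origin and the vertex
(`tripleLaw_real_cyclicTriples`). In polar coordinates an integration by parts
yields a recursion for the even moments of `D` (`distMoment_succ`): they are of the form
`α - β exp (-ξ² / 2)` with coefficients that are explicit and, for the values of `ξ` in question,
rational. Since `|D| ≤ |ξ| ≤ 2`, replacing `Φ - 1/2` by a Taylor polynomial costs little, and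
what remains is an inequality between rational numbers.
-/

namespace GaussianCapture

/-! ### Orientation of triples of vectors in the plane -/

/-- The determinant of the pair of vectors `p`, `q`: it is positive when `q` points to the left
of `p`. -/
def cross (p q : ℝ × ℝ) : ℝ := p.1 * q.2 - p.2 * q.1

/-- The triples of vectors each of which has the next one, in cyclic order, on the same strict
side. Up to degenerate triples these are the triangles containing the origin. -/
def cyclicTriples : Set ((ℝ × ℝ) × (ℝ × ℝ) × (ℝ × ℝ)) :=
  {p | (0 < cross p.1 p.2.1 ∧ 0 < cross p.2.1 p.2.2 ∧ 0 < cross p.2.2 p.1) ∨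
    (cross p.1 p.2.1 < 0 ∧ cross p.2.1 p.2.2 < 0 ∧ cross p.2.2 p.1 < 0)}

/-- The coordinates of a point relative to the origin `X`. -/
noncomputable def relCoord (X A : Plane) : ℝ × ℝ := (A 0 - X 0, A 1 - X 1)

lemma captures_iff_exists (A B C X : Plane) :
    Captures A B C X ↔ ∃ α β γ : ℝ, 0 ≤ α ∧ 0 ≤ β ∧ 0 ≤ γ ∧ α + β + γ = 1 ∧
      α • A + β • B + γ • C = X := by
  unfold Captures
  rw [convexHull_insert (by simp), convexHull_pair, mem_convexJoin]
  constructor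
  · rintro ⟨a, ha, y, hy, hX⟩
    rw [mem_singleton_iff] at ha
    subst ha
    obtain ⟨u, v, hu, hv, huv, rfl⟩ := hy
    obtain ⟨s, t, hs, ht, hst, rfl⟩ := hX
    refine ⟨s, t * u, t * v, hs, by positivity, by positivity, ?_, ?_⟩
    · linear_combination hst + t * huv
    · rw [smul_add, smul_smul, smul_smul, add_assoc]
  · rintro ⟨α, β, γ, hα, hβ, hγ, hs, rfl⟩
    refine ⟨A, rfl, ?_⟩
    rcases eq_or_lt_of_le (add_nonneg hβ hγ) with h | h
    · have hβ0 : β = 0 := by linarith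
      have hγ0 : γ = 0 := by linarith
      have hα1 : α = 1 := by linarith
      subst hβ0 hγ0 hα1
      exact ⟨B, left_mem_segment ℝ B C, by simpa using left_mem_segment ℝ A B⟩
    · refine ⟨(β / (β + γ)) • B + (γ / (β + γ)) • C,
        ⟨_, _, by positivity, by positivity, by field_simp, rfl⟩,
        ⟨α, β + γ, hα, h.le, by linarith, ?_⟩⟩
      rw [smul_add, smul_smul, smul_smul, mul_div_cancel₀ _ h.ne', mul_div_cancel₀ _ h.ne',
        add_assoc]

/-- A nondegenerate triangle contains `X` exactly when its vertices, seen from `X`, turn all three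
times in the same direction: crossing `α a + β b + γ c = 0` with `a`, `b`, `c` shows that the
barycentric coordinates are proportional to the three determinants. -/
lemma captures_iff_mem_cyclicTriples {A B C X : Plane}
    (hAB : cross (relCoord X A) (relCoord X B) ≠ 0)
    (hBC : cross (relCoord X B) (relCoord X C) ≠ 0)
    (hCA : cross (relCoord X C) (relCoord X A) ≠ 0) :
    Captures A B C X ↔ (relCoord X A, relCoord X B, relCoord X C) ∈ cyclicTriples := by
  rw [captures_iff_exists]
  simp only [cyclicTriples, mem_ofPred_eq]
  set u := cross (relCoord X A) (relCoord X B) with hu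
  set v := cross (relCoord X B) (relCoord X C) with hv
  set w := cross (relCoord X C) (relCoord X A) with hw
  simp only [cross, relCoord] at hu hv hw
  have key : ∀ α β γ : ℝ, α + β + γ = 1 → (α • A + β • B + γ • C = X ↔
      α * (A 0 - X 0) + β * (B 0 - X 0) + γ * (C 0 - X 0) = 0 ∧
      α * (A 1 - X 1) + β * (B 1 - X 1) + γ * (C 1 - X 1) = 0) := by
    intro α β γ h
    have h2 : α • A + β • B + γ • C = X ↔
        (α • A + β • B + γ • C) 0 = X 0 ∧ (α • A + β • B + γ • C) 1 = X 1 := by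
      constructor
      · intro h; rw [h]; exact ⟨rfl, rfl⟩
      · rintro ⟨h0, h1⟩
        ext i
        fin_cases i
        · exact h0
        · exact h1
    rw [h2]
    simp only [PiLp.add_apply, PiLp.smul_apply, smul_eq_mul]
    constructor
    · rintro ⟨h0, h1⟩
      exact ⟨by linear_combination h0 - X 0 * h, by linear_combination h1 - X 1 * h⟩
    · rintro ⟨h0, h1⟩
      exact ⟨by linear_combination h0 + X 0 * h, by linear_combination h1 + X 1 * h⟩
  constructor
  · rintro ⟨α, β, γ, hα, hβ, hγ, hs, hX⟩
    obtain ⟨h0, h1⟩ := (key _ _ _ hs).1 hX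
    -- the cross products of the relation with the three vectors
    have e1 : β * u = γ * w := by
      rw [hu, hw]; linear_combination (A 0 - X 0) * h1 - (A 1 - X 1) * h0
    have e2 : γ * v = α * u := by
      rw [hu, hv]; linear_combination (B 0 - X 0) * h1 - (B 1 - X 1) * h0
    have e3 : α * w = β * v := by
      rw [hv, hw]; linear_combination (C 0 - X 0) * h1 - (C 1 - X 1) * h0
    have p1 : α ≠ 0 := by
      rintro rfl
      have : γ = 0 := by simpa [hBC] using e2
      have : β = 0 := by simpa [hBC] using e3.symm
      linarith
    have p2 : β ≠ 0 := by
      rintro rfl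
      have : γ = 0 := by simpa [hCA] using e1.symm
      exact p1 (by simpa [hCA] using e3)
    have p3 : γ ≠ 0 := by
      rintro rfl
      exact p2 (by simpa [hAB] using e1)
    have p1 := lt_of_le_of_ne hα (Ne.symm p1)
    have p2 := lt_of_le_of_ne hβ (Ne.symm p2)
    have p3 := lt_of_le_of_ne hγ (Ne.symm p3)
    rcases lt_or_gt_of_ne hAB with h | h
    · right
      exact ⟨h, by nlinarith [mul_neg_of_pos_of_neg p1 h],
        by nlinarith [mul_neg_of_pos_of_neg p2 h]⟩
    · left
      exact ⟨h, by nlinarith [mul_pos p1 h], by nlinarith [mul_pos p2 h]⟩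
  · intro h
    have hpos : u + v + w ≠ 0 ∧ 0 ≤ v / (u + v + w) ∧ 0 ≤ w / (u + v + w) ∧
        0 ≤ u / (u + v + w) := by
      rcases h with ⟨h1, h2, h3⟩ | ⟨h1, h2, h3⟩
      · exact ⟨by positivity, by positivity, by positivity, by positivity⟩
      · have : u + v + w < 0 := by linarith
        exact ⟨this.ne, div_nonneg_of_nonpos h2.le this.le, div_nonneg_of_nonpos h3.le this.le,
          div_nonneg_of_nonpos h1.le this.le⟩
    obtain ⟨h0, h1, h2, h3⟩ := hpos
    have hs : v / (u + v + w) + w / (u + v + w) + u / (u + v + w) = 1 := by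
      field_simp; ring
    refine ⟨_, _, _, h1, h2, h3, hs, (key _ _ _ hs).2 ⟨?_, ?_⟩⟩
    · rw [div_mul_eq_mul_div, div_mul_eq_mul_div, div_mul_eq_mul_div, ← add_div, ← add_div,
        div_eq_zero_iff]
      left; rw [hu, hv, hw]; ring
    · rw [div_mul_eq_mul_div, div_mul_eq_mul_div, div_mul_eq_mul_div, ← add_div, ← add_div,
        div_eq_zero_iff]
      left; rw [hu, hv, hw]; ring

/-! ### The law of a Gaussian triangle seen from a point of the first axis -/

/-- The law of a standard Gaussian point of the plane relative to the point `(ξ, 0)`. -/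
noncomputable def relLaw (ξ : ℝ) : Measure (ℝ × ℝ) :=
  (gaussianReal (-ξ) 1).prod (gaussianReal 0 1)

instance (ξ : ℝ) : IsProbabilityMeasure (relLaw ξ) := by
  unfold relLaw; infer_instance

/-- The joint law of three independent standard Gaussian points relative to `(ξ, 0)`. -/
noncomputable def tripleLaw (ξ : ℝ) : Measure ((ℝ × ℝ) × (ℝ × ℝ) × (ℝ × ℝ)) :=
  (relLaw ξ).prod ((relLaw ξ).prod (relLaw ξ))

instance (ξ : ℝ) : IsProbabilityMeasure (tripleLaw ξ) := by
  unfold tripleLaw; infer_instance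

lemma hasLaw_relCoord (ξ : ℝ) :
    HasLaw (relCoord !₂[ξ, 0]) (relLaw ξ) (stdGaussian Plane) := by
  have hm : Measurable (relCoord !₂[ξ, 0]) := by
    unfold relCoord; fun_prop
  refine ⟨hm.aemeasurable, ?_⟩
  have h1 : MeasurePreserving (fun x : ℝ ↦ x - ξ) (gaussianReal 0 1) (gaussianReal (-ξ) 1) :=
    ⟨by fun_prop, by rw [gaussianReal_map_sub_const, zero_sub]⟩
  have h2 := (h1.prod (MeasurePreserving.id (gaussianReal 0 1))).comp
    (measurePreserving_piFinTwo (fun _ : Fin 2 ↦ gaussianReal 0 1))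
  rw [← map_pi_eq_stdGaussian, Measure.map_map hm (by fun_prop), relLaw, ← h2.map_eq]
  congr 1
  ext x <;> simp [relCoord]

lemma measurable_cross : Measurable (fun p : (ℝ × ℝ) × (ℝ × ℝ) ↦ cross p.1 p.2) := by
  unfold cross; fun_prop

@[fun_prop]
lemma measurable_cross_of_measurable {α : Type*} [MeasurableSpace α] {f g : α → ℝ × ℝ}
    (hf : Measurable f) (hg : Measurable g) : Measurable (fun x ↦ cross (f x) (g x)) :=
  measurable_cross.comp (hf.prodMk hg)

lemma measurableSet_cyclicTriples : MeasurableSet cyclicTriples := by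
  unfold cyclicTriples
  have h1 : Measurable fun p : (ℝ × ℝ) × (ℝ × ℝ) × (ℝ × ℝ) ↦ cross p.1 p.2.1 := by fun_prop
  have h2 : Measurable fun p : (ℝ × ℝ) × (ℝ × ℝ) × (ℝ × ℝ) ↦ cross p.2.1 p.2.2 := by fun_prop
  have h3 : Measurable fun p : (ℝ × ℝ) × (ℝ × ℝ) × (ℝ × ℝ) ↦ cross p.2.2 p.1 := by fun_prop
  measurability

lemma ae_gaussianReal_ne (m x : ℝ) : ∀ᵐ y ∂(gaussianReal m 1), y ≠ x := by
  have := nullSingletonClass_gaussianReal (μ := m) (v := 1) one_ne_zero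
  exact Measure.ae_ne _ x

lemma ae_relLaw_fst_ne_zero (ξ : ℝ) : ∀ᵐ p ∂(relLaw ξ), p.1 ≠ 0 :=
  Measure.quasiMeasurePreserving_fst.ae (ae_gaussianReal_ne (-ξ) 0)

lemma ae_cross_ne_zero (ξ : ℝ) :
    ∀ᵐ p ∂((relLaw ξ).prod (relLaw ξ)), cross p.1 p.2 ≠ 0 := by
  rw [Measure.ae_prod_iff_ae_ae (p := fun p ↦ cross p.1 p.2 ≠ 0)
    (measurable_cross (measurableSet_singleton 0).compl)]
  filter_upwards [ae_relLaw_fst_ne_zero ξ] with a ha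
  rw [relLaw, Measure.ae_prod_iff_ae_ae (p := fun p ↦ cross a p ≠ 0)
    ((show Measurable fun p ↦ cross a p by fun_prop) (measurableSet_singleton 0).compl)]
  refine Filter.Eventually.of_forall fun x ↦ ?_
  filter_upwards [ae_gaussianReal_ne 0 (a.2 * x / a.1)] with y hy h
  apply hy
  simp only [cross] at h
  field_simp
  linarith

lemma cross_swap (p q : ℝ × ℝ) : cross q p = - cross p q := by
  unfold cross; ring

lemma ae_cross_ne_zero_tripleLaw (ξ : ℝ) :
    ∀ᵐ p ∂(tripleLaw ξ), cross p.1 p.2.1 ≠ 0 ∧ cross p.2.1 p.2.2 ≠ 0 ∧ cross p.2.2 p.1 ≠ 0 := by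
  have h := ae_cross_ne_zero ξ
  have h1 : MeasurePreserving (fun p : (ℝ × ℝ) × (ℝ × ℝ) × (ℝ × ℝ) ↦ (p.1, p.2.1))
      (tripleLaw ξ) ((relLaw ξ).prod (relLaw ξ)) :=
    (MeasurePreserving.id _).prod measurePreserving_fst
  have h2 : MeasurePreserving (fun p : (ℝ × ℝ) × (ℝ × ℝ) × (ℝ × ℝ) ↦ (p.1, p.2.2))
      (tripleLaw ξ) ((relLaw ξ).prod (relLaw ξ)) :=
    (MeasurePreserving.id _).prod measurePreserving_snd
  have h3 : MeasurePreserving (fun p : (ℝ × ℝ) × (ℝ × ℝ) × (ℝ × ℝ) ↦ p.2)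
      (tripleLaw ξ) ((relLaw ξ).prod (relLaw ξ)) := measurePreserving_snd
  filter_upwards [h1.quasiMeasurePreserving.ae h, h2.quasiMeasurePreserving.ae h,
    h3.quasiMeasurePreserving.ae h] with p p1 p2 p3
  refine ⟨p1, p3, ?_⟩
  rw [cross_swap]
  exact neg_ne_zero.2 p2

section Reduction

variable {Ω : Type*} [MeasurableSpace Ω] {μ : Measure Ω} [IsProbabilityMeasure μ]
  {A B C : Ω → Plane}

lemma hasLaw_triple (hA : HasLaw A (stdGaussian Plane) μ)
    (hB : HasLaw B (stdGaussian Plane) μ) (hC : HasLaw C (stdGaussian Plane) μ)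
    (hABC : iIndepFun ![A, B, C] μ) (ξ : ℝ) :
    HasLaw (fun ω ↦ (relCoord !₂[ξ, 0] (A ω), relCoord !₂[ξ, 0] (B ω), relCoord !₂[ξ, 0] (C ω)))
      (tripleLaw ξ) μ := by
  have hm : ∀ i, AEMeasurable (![A, B, C] i) μ := by
    intro i
    fin_cases i
    exacts [hA.aemeasurable, hB.aemeasurable, hC.aemeasurable]
  have h1 : IndepFun B C μ := by
    simpa using hABC.indepFun (i := 1) (j := 2) (by decide)
  have h2 : IndepFun A (fun ω ↦ (B ω, C ω)) μ := by
    simpa using (hABC.indepFun_prodMk₀ hm 1 2 0 (by decide) (by decide)).symm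
  have hBC : HasLaw (fun ω ↦ (B ω, C ω)) ((stdGaussian Plane).prod (stdGaussian Plane)) μ :=
    ⟨hB.aemeasurable.prodMk hC.aemeasurable, by
      rw [(indepFun_iff_map_prod_eq_prod_map_map hB.aemeasurable hC.aemeasurable).1 h1,
        hB.map_eq, hC.map_eq]⟩
  have hall : HasLaw (fun ω ↦ (A ω, B ω, C ω))
      ((stdGaussian Plane).prod ((stdGaussian Plane).prod (stdGaussian Plane))) μ :=
    ⟨hA.aemeasurable.prodMk hBC.aemeasurable, by
      rw [(indepFun_iff_map_prod_eq_prod_map_map hA.aemeasurable hBC.aemeasurable).1 h2,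
        hA.map_eq, hBC.map_eq]⟩
  have hp : MeasurePreserving (relCoord !₂[ξ, 0]) (stdGaussian Plane) (relLaw ξ) :=
    (hasLaw_relCoord ξ).measurePreserving (by unfold relCoord; fun_prop)
  exact (hp.prod (hp.prod hp)).hasLaw.comp hall

lemma captureProb_eq_tripleLaw (hA : HasLaw A (stdGaussian Plane) μ)
    (hB : HasLaw B (stdGaussian Plane) μ) (hC : HasLaw C (stdGaussian Plane) μ)
    (hABC : iIndepFun ![A, B, C] μ) (ξ : ℝ) :
    captureProb μ A B C ξ 0 = (tripleLaw ξ).real cyclicTriples := by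
  have hlaw := hasLaw_triple hA hB hC hABC ξ
  have hae := ae_cross_ne_zero_tripleLaw ξ
  rw [← hlaw.map_eq] at hae
  have hae' := ae_of_ae_map hlaw.aemeasurable hae
  have hs := hlaw.measureReal_eq (p := fun p ↦ p ∈ cyclicTriples) measurableSet_cyclicTriples
  rw [ofPred_mem_eq] at hs
  rw [captureProb, ← hs]
  apply measureReal_congr
  filter_upwards [hae'] with ω hω
  exact propext (captures_iff_mem_cyclicTriples hω.1 hω.2.1 hω.2.2)

/-- Reflecting the plane in a line through the origin takes `(ξ, η)` to the point of the first
half-axis with the same norm, and preserves the standard Gaussian law. -/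
lemma captureProb_eq_captureProb_norm (hA : HasLaw A (stdGaussian Plane) μ)
    (hB : HasLaw B (stdGaussian Plane) μ) (hC : HasLaw C (stdGaussian Plane) μ)
    (hABC : iIndepFun ![A, B, C] μ) (ξ η : ℝ) :
    captureProb μ A B C ξ η = captureProb μ A B C (Real.sqrt (ξ ^ 2 + η ^ 2)) 0 := by
  set r := Real.sqrt (ξ ^ 2 + η ^ 2) with hr
  have hnorm : ‖(!₂[ξ, η] : Plane)‖ = ‖(!₂[r, 0] : Plane)‖ := by
    simp only [EuclideanSpace.norm_eq, Fin.sum_univ_two]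
    simp [hr, Real.sq_sqrt (show 0 ≤ ξ ^ 2 + η ^ 2 by positivity)]
  -- if the two points agree, this is the reflection in the whole plane, that is, the identity
  set R : Plane ≃ₗᵢ[ℝ] Plane := (ℝ ∙ ((!₂[ξ, η] : Plane) - !₂[r, 0]))ᗮ.reflection with hR
  have hRX : R !₂[ξ, η] = !₂[r, 0] := Submodule.reflection_sub hnorm
  have hRlaw : HasLaw R (stdGaussian Plane) (stdGaussian Plane) :=
    ⟨R.continuous.aemeasurable, stdGaussian_map R⟩
  have hind : iIndepFun ![R ∘ A, R ∘ B, R ∘ C] μ := by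
    have := hABC.comp (g := fun _ ↦ R) (fun _ ↦ R.continuous.measurable)
    convert this using 2 with i
    fin_cases i <;> rfl
  rw [captureProb_eq_tripleLaw hA hB hC hABC, ← captureProb_eq_tripleLaw
    (hRlaw.comp hA) (hRlaw.comp hB) (hRlaw.comp hC) hind, captureProb, captureProb]
  congr 1
  ext ω
  simp only [mem_ofPred_eq, captures_iff_exists, ← hRX, Function.comp_apply, ← map_smul, ← map_add,
    R.injective.eq_iff]

end Reduction

/-! ### Cyclic symmetry -/

lemma measurePreserving_rotate (ξ : ℝ) :
    MeasurePreserving (fun p : (ℝ × ℝ) × (ℝ × ℝ) × (ℝ × ℝ) ↦ (p.2.1, p.2.2, p.1))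
      (tripleLaw ξ) (tripleLaw ξ) :=
  (measurePreserving_prodAssoc _ _ _).comp Measure.measurePreserving_swap

/-- If almost surely a triple lies in `U` exactly when one of its three cyclic rotations lies
in `V`, and at most one of them does, then `U` is three times as likely as `V`. -/
lemma tripleLaw_real_eq_three_mul (ξ : ℝ) {U V : Set ((ℝ × ℝ) × (ℝ × ℝ) × (ℝ × ℝ))}
    (hU : MeasurableSet U) (hV : MeasurableSet V)
    (h : ∀ᵐ p ∂(tripleLaw ξ),
      (p ∈ U ↔ p ∈ V ∨ (p.2.1, p.2.2, p.1) ∈ V ∨ (p.2.2, p.1, p.2.1) ∈ V) ∧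
      ¬ (p ∈ V ∧ (p.2.1, p.2.2, p.1) ∈ V) ∧ ¬ (p ∈ V ∧ (p.2.2, p.1, p.2.1) ∈ V) ∧
      ¬ ((p.2.1, p.2.2, p.1) ∈ V ∧ (p.2.2, p.1, p.2.1) ∈ V)) :
    (tripleLaw ξ).real U = 3 * (tripleLaw ξ).real V := by
  have hσ := measurePreserving_rotate ξ
  have hσ2 := hσ.comp hσ
  let f : (ℝ × ℝ) × (ℝ × ℝ) × (ℝ × ℝ) → ℝ := V.indicator 1
  have hVf : Measurable f :=
    measurable_one.indicator hV
  have hVi : Integrable f (tripleLaw ξ) :=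
    (integrable_const (1 : ℝ)).indicator hV
  have e1 : ∫ p, f (p.2.1, p.2.2, p.1) ∂(tripleLaw ξ) =
      (tripleLaw ξ).real V := by
    rw [← integral_indicator_one hV]
    change _ = ∫ p, f p ∂(tripleLaw ξ)
    conv_rhs => rw [← hσ.map_eq, integral_map hσ.measurable.aemeasurable
      hVf.aestronglyMeasurable]
  have e2 : ∫ p, f (p.2.2, p.1, p.2.1) ∂(tripleLaw ξ) =
      (tripleLaw ξ).real V := by
    rw [← integral_indicator_one hV]
    change _ = ∫ p, f p ∂(tripleLaw ξ)
    conv_rhs => rw [← hσ2.map_eq, integral_map hσ2.measurable.aemeasurable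
      hVf.aestronglyMeasurable]
    rfl
  have i1 : Integrable (fun p : (ℝ × ℝ) × (ℝ × ℝ) × (ℝ × ℝ) ↦
      f (p.2.1, p.2.2, p.1)) (tripleLaw ξ) :=
    hσ.integrable_comp_of_integrable hVi
  have i2 : Integrable (fun p : (ℝ × ℝ) × (ℝ × ℝ) × (ℝ × ℝ) ↦
      f (p.2.2, p.1, p.2.1)) (tripleLaw ξ) :=
    hσ2.integrable_comp_of_integrable hVi
  have e3 : ∫ p, U.indicator 1 p ∂(tripleLaw ξ) =
      ∫ p, (f p + f (p.2.1, p.2.2, p.1) +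
        f (p.2.2, p.1, p.2.1)) ∂(tripleLaw ξ) := by
    apply integral_congr_ae
    filter_upwards [h] with p hp
    by_cases h1 : p ∈ V <;> by_cases h2 : (p.2.1, p.2.2, p.1) ∈ V <;>
      by_cases h3 : (p.2.2, p.1, p.2.1) ∈ V <;> by_cases h4 : p ∈ U <;>
      simp_all [f]
  rw [integral_indicator_one hU,
    integral_add (f := fun p ↦ f p + f (p.2.1, p.2.2, p.1)) (hVi.add i1) i2,
    integral_add hVi i1,
    show ∫ p, f p ∂(tripleLaw ξ) = _ from integral_indicator_one hV, e1, e2] at e3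
  rw [e3]; ring

lemma cross_cyclic_relation (a b c : ℝ × ℝ) :
    c.1 * cross a b + a.1 * cross b c + b.1 * cross c a = 0 := by
  unfold cross; ring

/-- The triples in which the first coordinate of the last vector has the sign opposite to the two
others, and the triangle contains the origin. Since the edges at the last vertex are those that
meet the second axis, this only depends on two determinants. -/
def lastOdd : Set ((ℝ × ℝ) × (ℝ × ℝ) × (ℝ × ℝ)) :=
  {p | ((0 < p.1.1 ∧ 0 < p.2.1.1 ∧ p.2.2.1 < 0) ∨ (p.1.1 < 0 ∧ p.2.1.1 < 0 ∧ 0 < p.2.2.1)) ∧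
    0 < cross p.2.1 p.2.2 * cross p.2.2 p.1}

lemma measurableSet_lastOdd : MeasurableSet lastOdd := by
  unfold lastOdd
  have h2 : Measurable fun p : (ℝ × ℝ) × (ℝ × ℝ) × (ℝ × ℝ) ↦
    cross p.2.1 p.2.2 * cross p.2.2 p.1 := by fun_prop
  measurability

lemma mem_lastOdd_iff (p : (ℝ × ℝ) × (ℝ × ℝ) × (ℝ × ℝ)) :
    p ∈ lastOdd ↔ ((0 < p.1.1 ∧ 0 < p.2.1.1 ∧ p.2.2.1 < 0) ∨
      (p.1.1 < 0 ∧ p.2.1.1 < 0 ∧ 0 < p.2.2.1)) ∧ p ∈ cyclicTriples := by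
  obtain ⟨a, b, c⟩ := p
  have hrel := cross_cyclic_relation a b c
  simp only [lastOdd, cyclicTriples, mem_ofPred_eq]
  set u := cross a b
  set v := cross b c
  set w := cross c a
  refine and_congr_right fun hs ↦ ?_
  constructor
  · intro h
    rcases pos_and_pos_or_neg_and_neg_of_mul_pos h with ⟨hv, hw⟩ | ⟨hv, hw⟩
    · refine Or.inl ⟨?_, hv, hw⟩
      rcases hs with ⟨h1, h2, h3⟩ | ⟨h1, h2, h3⟩
      · by_contra hu
        nlinarith [mul_pos h1 hv, mul_pos h2 hw, mul_nonneg_of_nonpos_of_nonpos h3.le (not_lt.1 hu)]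
      · by_contra hu
        nlinarith [mul_neg_of_neg_of_pos h1 hv, mul_neg_of_neg_of_pos h2 hw,
          mul_nonpos_of_nonneg_of_nonpos h3.le (not_lt.1 hu)]
    · refine Or.inr ⟨?_, hv, hw⟩
      rcases hs with ⟨h1, h2, h3⟩ | ⟨h1, h2, h3⟩
      · by_contra hu
        nlinarith [mul_neg_of_pos_of_neg h1 hv, mul_neg_of_pos_of_neg h2 hw,
          mul_nonpos_of_nonpos_of_nonneg h3.le (not_lt.1 hu)]
      · by_contra hu
        nlinarith [mul_pos_of_neg_of_neg h1 hv, mul_pos_of_neg_of_neg h2 hw,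
          mul_nonneg h3.le (not_lt.1 hu)]
  · rintro (⟨-, hv, hw⟩ | ⟨-, hv, hw⟩)
    · exact mul_pos hv hw
    · exact mul_pos_of_neg_of_neg hv hw

lemma mem_cyclicTriples_rotate (a b c : ℝ × ℝ) :
    (b, c, a) ∈ cyclicTriples ↔ (a, b, c) ∈ cyclicTriples := by
  simp only [cyclicTriples, mem_ofPred_eq]; tauto

lemma ae_tripleLaw_fst_ne_zero (ξ : ℝ) :
    ∀ᵐ p ∂(tripleLaw ξ), p.1.1 ≠ 0 ∧ p.2.1.1 ≠ 0 ∧ p.2.2.1 ≠ 0 := by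
  have h := ae_relLaw_fst_ne_zero ξ
  have hσ := measurePreserving_rotate ξ
  have h1 : ∀ᵐ p ∂(tripleLaw ξ), p.1.1 ≠ 0 := Measure.quasiMeasurePreserving_fst.ae h
  have h2 := hσ.quasiMeasurePreserving.ae h1
  have h3 := hσ.quasiMeasurePreserving.ae h2
  filter_upwards [h1, h2, h3] with p p1 p2 p3 using ⟨p1, p2, p3⟩

lemma tripleLaw_real_cyclicTriples_eq_lastOdd (ξ : ℝ) :
    (tripleLaw ξ).real cyclicTriples = 3 * (tripleLaw ξ).real lastOdd := by
  refine tripleLaw_real_eq_three_mul ξ measurableSet_cyclicTriples measurableSet_lastOdd ?_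
  filter_upwards [ae_tripleLaw_fst_ne_zero ξ] with ⟨a, b, c⟩ ⟨ha, hb, hc⟩
  have hrel := cross_cyclic_relation a b c
  simp only at ha hb hc
  simp only [mem_lastOdd_iff]
  rw [mem_cyclicTriples_rotate b c a, mem_cyclicTriples_rotate a b c]
  have hpos : (a, b, c) ∈ cyclicTriples → ¬ (0 < a.1 ∧ 0 < b.1 ∧ 0 < c.1) := by
    rintro (⟨h1, h2, h3⟩ | ⟨h1, h2, h3⟩) ⟨p1, p2, p3⟩
    · nlinarith [mul_pos p3 h1, mul_pos p1 h2, mul_pos p2 h3]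
    · nlinarith [mul_neg_of_pos_of_neg p3 h1, mul_neg_of_pos_of_neg p1 h2,
        mul_neg_of_pos_of_neg p2 h3]
  have hneg : (a, b, c) ∈ cyclicTriples → ¬ (a.1 < 0 ∧ b.1 < 0 ∧ c.1 < 0) := by
    rintro (⟨h1, h2, h3⟩ | ⟨h1, h2, h3⟩) ⟨p1, p2, p3⟩
    · nlinarith [mul_neg_of_neg_of_pos p3 h1, mul_neg_of_neg_of_pos p1 h2,
        mul_neg_of_neg_of_pos p2 h3]
    · nlinarith [mul_pos_of_neg_of_neg p3 h1, mul_pos_of_neg_of_neg p1 h2,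
        mul_pos_of_neg_of_neg p2 h3]
  by_cases hP : (a, b, c) ∈ cyclicTriples <;>
  rcases lt_or_gt_of_ne ha with ha | ha <;> rcases lt_or_gt_of_ne hb with hb | hb <;>
    rcases lt_or_gt_of_ne hc with hc | hc <;> simp_all [not_lt_of_gt]

/-- The triples in which the second and the third vector lie strictly to the left of the first. -/
def bothLeft : Set ((ℝ × ℝ) × (ℝ × ℝ) × (ℝ × ℝ)) :=
  {p | 0 < cross p.1 p.2.1 ∧ 0 < cross p.1 p.2.2}

lemma measurableSet_bothLeft : MeasurableSet bothLeft := by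
  unfold bothLeft
  have h1 : Measurable fun p : (ℝ × ℝ) × (ℝ × ℝ) × (ℝ × ℝ) ↦ cross p.1 p.2.1 := by fun_prop
  have h2 : Measurable fun p : (ℝ × ℝ) × (ℝ × ℝ) × (ℝ × ℝ) ↦ cross p.1 p.2.2 := by fun_prop
  measurability

/-- A triangle misses the origin exactly when it is seen from there under an angle less than `π`;
then exactly one vertex has the two others on its left. -/
lemma tripleLaw_real_cyclicTriples_eq_bothLeft (ξ : ℝ) :
    (tripleLaw ξ).real cyclicTriples = 1 - 3 * (tripleLaw ξ).real bothLeft := by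
  have h : (tripleLaw ξ).real cyclicTriplesᶜ = 3 * (tripleLaw ξ).real bothLeft := by
    refine tripleLaw_real_eq_three_mul ξ measurableSet_cyclicTriples.compl
      measurableSet_bothLeft ?_
    filter_upwards [ae_cross_ne_zero_tripleLaw ξ] with ⟨a, b, c⟩ ⟨hu, hv, hw⟩
    simp only at hu hv hw
    simp only [bothLeft, cyclicTriples, mem_ofPred_eq, mem_compl_iff, cross_swap c b,
      cross_swap a c, cross_swap b a]
    rcases lt_or_gt_of_ne hu with h1 | h1 <;> rcases lt_or_gt_of_ne hv with h2 | h2 <;>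
      rcases lt_or_gt_of_ne hw with h3 | h3 <;>
      simp_all [cross_swap b a, cross_swap c b, cross_swap a c, not_lt_of_gt]
  rw [probReal_compl_eq_one_sub measurableSet_cyclicTriples] at h
  linarith

/-! ### The centred normal distribution function -/

/-- The integral of `exp (-u² / 2)` from `0` to `x`. -/
noncomputable def gaussInt (x : ℝ) : ℝ := ∫ u in (0 : ℝ)..x, Real.exp (-u ^ 2 / 2)

lemma continuous_exp_neg_sq_div_two : Continuous fun u : ℝ ↦ Real.exp (-u ^ 2 / 2) := by
  fun_prop

lemma hasDerivAt_gaussInt (x : ℝ) : HasDerivAt gaussInt (Real.exp (-x ^ 2 / 2)) x :=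
  intervalIntegral.integral_hasDerivAt_right
    (continuous_exp_neg_sq_div_two.intervalIntegrable _ _)
    (continuous_exp_neg_sq_div_two.stronglyMeasurableAtFilter _ _)
    continuous_exp_neg_sq_div_two.continuousAt

@[fun_prop]
lemma continuous_gaussInt : Continuous gaussInt :=
  continuous_iff_continuousAt.2 fun x ↦ (hasDerivAt_gaussInt x).continuousAt

lemma gaussInt_zero : gaussInt 0 = 0 := by simp [gaussInt]

lemma gaussInt_neg (x : ℝ) : gaussInt (-x) = -gaussInt x := by
  have h := intervalIntegral.integral_comp_neg (a := 0) (b := x)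
    (fun u : ℝ ↦ Real.exp (-u ^ 2 / 2))
  simp only [neg_sq, neg_zero] at h
  rw [gaussInt, gaussInt, h, intervalIntegral.integral_symm]

lemma abs_gaussInt_le_abs (x : ℝ) : |gaussInt x| ≤ |x| := by
  have h := intervalIntegral.norm_integral_le_of_norm_le_const (a := 0) (b := x)
    (f := fun u : ℝ ↦ Real.exp (-u ^ 2 / 2)) (C := 1) (fun u _ ↦ by
      rw [Real.norm_eq_abs, Real.abs_exp, Real.exp_le_one_iff]; nlinarith [sq_nonneg u])
  simpa [gaussInt] using h

lemma integrable_exp_neg_sq_div_two : Integrable fun u : ℝ ↦ Real.exp (-u ^ 2 / 2) := by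
  have h := integrable_exp_neg_mul_sq (b := 1 / 2) (by norm_num)
  convert h using 3
  ring

lemma integral_Ioi_zero_exp_neg_sq_div_two :
    ∫ u in Ioi (0 : ℝ), Real.exp (-u ^ 2 / 2) = √(2 * Real.pi) / 2 := by
  have h := integral_gaussian_Ioi (1 / 2)
  rw [show Real.pi / (1 / 2) = 2 * Real.pi by ring] at h
  rw [← h]
  congr 1 with u
  ring_nf

lemma integral_Ioi_exp_neg_sq_div_two (x : ℝ) :
    ∫ u in Ioi x, Real.exp (-u ^ 2 / 2) = √(2 * Real.pi) / 2 - gaussInt x := by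
  have h := intervalIntegral.integral_interval_add_Ioi (a := 0) (b := x)
    (integrable_exp_neg_sq_div_two.integrableOn) (integrable_exp_neg_sq_div_two.integrableOn)
  rw [integral_Ioi_zero_exp_neg_sq_div_two] at h
  rw [gaussInt, ← h]
  ring

lemma gaussianPDFReal_eq (m x : ℝ) :
    gaussianPDFReal m 1 x = (√(2 * Real.pi))⁻¹ * Real.exp (-(x - m) ^ 2 / 2) := by
  simp [gaussianPDFReal]

lemma gaussianReal_real_Ioi (x : ℝ) :
    (gaussianReal 0 1).real (Ioi x) = 1 / 2 - gaussInt x / √(2 * Real.pi) := by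
  have hs : (0 : ℝ) < √(2 * Real.pi) := by positivity
  rw [Measure.real, gaussianReal_apply_eq_integral 0 one_ne_zero, ENNReal.toReal_ofReal
    (integral_nonneg fun u ↦ gaussianPDFReal_nonneg _ _ _)]
  simp only [gaussianPDFReal_eq, sub_zero]
  rw [integral_const_mul, integral_Ioi_exp_neg_sq_div_two]
  field_simp

lemma gaussianReal_real_Iio (x : ℝ) :
    (gaussianReal 0 1).real (Iio x) = 1 / 2 + gaussInt x / √(2 * Real.pi) := by
  have h : (gaussianReal 0 1).map (fun y ↦ -y) = gaussianReal 0 1 := by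
    rw [gaussianReal_map_neg, neg_zero]
  rw [← h, map_measureReal_apply measurable_neg measurableSet_Iio, neg_preimage, neg_Iio,
    gaussianReal_real_Ioi, gaussInt_neg]
  ring

/-- By symmetry `gaussInt` is `√(2π)` times a probability minus `1 / 2`. -/
lemma abs_gaussInt_le (x : ℝ) : |gaussInt x| ≤ √(2 * Real.pi) / 2 := by
  have hs : (0 : ℝ) < √(2 * Real.pi) := by positivity
  have h1 := measureReal_nonneg (μ := gaussianReal 0 1) (s := Ioi x)
  have h2 := measureReal_nonneg (μ := gaussianReal 0 1) (s := Iio x)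
  rw [gaussianReal_real_Ioi] at h1
  rw [gaussianReal_real_Iio] at h2
  have h3 : gaussInt x / √(2 * Real.pi) ≤ 1 / 2 := by linarith
  have h4 : -(1 / 2) ≤ gaussInt x / √(2 * Real.pi) := by linarith
  rw [div_le_iff₀ hs] at h3
  rw [le_div_iff₀ hs] at h4
  rw [abs_le]
  constructor <;> linarith

/-! ### The capture probability as a mean over one vertex -/

lemma real_prod_eq_integral {α β : Type*} [MeasurableSpace α] [MeasurableSpace β]
    (μ : Measure α) (ν : Measure β) [IsFiniteMeasure μ] [IsFiniteMeasure ν] {s : Set (α × β)}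
    (hs : MeasurableSet s) :
    (μ.prod ν).real s = ∫ x, ν.real (Prod.mk x ⁻¹' s) ∂μ := by
  rw [Measure.real, Measure.prod_apply hs, ← integral_toReal
    (measurable_measure_prodMk_left hs).aemeasurable
    (Filter.Eventually.of_forall fun x ↦ measure_lt_top _ _)]
  rfl

/-- The signed distance of the point `(-ξ, 0)` to the line through the origin and `p`. -/
noncomputable def sideDist (ξ : ℝ) (p : ℝ × ℝ) : ℝ := ξ * (p.2 / √(p.1 ^ 2 + p.2 ^ 2))

lemma measurable_sideDist (ξ : ℝ) : Measurable (sideDist ξ) := by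
  unfold sideDist; fun_prop

lemma relLaw_map_linear {u v : ℝ} (huv : u ^ 2 + v ^ 2 = 1) (ξ : ℝ) :
    (relLaw ξ).map (fun p ↦ u * p.1 + v * p.2) = gaussianReal (-(ξ * u)) 1 := by
  have hind : IndepFun (fun p : ℝ × ℝ ↦ u * p.1) (fun p ↦ v * p.2) (relLaw ξ) :=
    indepFun_prod (measurable_const_mul u) (measurable_const_mul v)
  have h1 : (relLaw ξ).map (fun p ↦ u * p.1) = _ :=
    (Measure.map_map (measurable_const_mul u) measurable_fst).symm.trans (by
      rw [relLaw, measurePreserving_fst.map_eq, gaussianReal_map_const_mul])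
  have h2 : (relLaw ξ).map (fun p ↦ v * p.2) = _ :=
    (Measure.map_map (measurable_const_mul v) measurable_snd).symm.trans (by
      rw [relLaw, measurePreserving_snd.map_eq, gaussianReal_map_const_mul])
  have h := gaussianReal_add_gaussianReal_of_indepFun hind h1 h2
  have hv : NNReal.mk (u ^ 2) (sq_nonneg u) * 1 + NNReal.mk (v ^ 2) (sq_nonneg v) * 1 = 1 :=
    NNReal.coe_injective (by simp [huv])
  rw [hv, show u * -ξ + v * 0 = -(ξ * u) by ring] at h
  exact h

lemma relLaw_real_left {ξ : ℝ} {a : ℝ × ℝ} (ha : a.1 ≠ 0) :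
    (relLaw ξ).real {b | 0 < cross a b} = 1 / 2 + gaussInt (sideDist ξ a) / √(2 * Real.pi) := by
  set r := √(a.1 ^ 2 + a.2 ^ 2) with hr
  have hpos : 0 < a.1 ^ 2 + a.2 ^ 2 := by positivity
  have hr0 : 0 < r := Real.sqrt_pos.2 hpos
  have hrr : r ^ 2 = a.1 ^ 2 + a.2 ^ 2 := Real.sq_sqrt hpos.le
  have huv : (-(a.2 / r)) ^ 2 + (a.1 / r) ^ 2 = 1 := by
    field_simp; linarith
  have hset : {b : ℝ × ℝ | 0 < cross a b} =
      (fun p : ℝ × ℝ ↦ -(a.2 / r) * p.1 + a.1 / r * p.2) ⁻¹' Ioi 0 := by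
    ext b
    have : -(a.2 / r) * b.1 + a.1 / r * b.2 = cross a b / r := by
      unfold cross; field_simp; ring
    rw [mem_ofPred_eq, mem_preimage, mem_Ioi, this, div_pos_iff_of_pos_right hr0]
  have h := relLaw_map_linear huv ξ
  -- the unit normal of the line through `a` makes the determinant normal with variance `1`
  rw [hset, ← map_measureReal_apply (by fun_prop) measurableSet_Ioi, h]
  have hshift : (gaussianReal 0 1).map (fun x ↦ x + -(ξ * -(a.2 / r))) =
      gaussianReal (-(ξ * -(a.2 / r))) 1 := by
    rw [gaussianReal_map_add_const, zero_add]
  rw [← hshift, map_measureReal_apply (by fun_prop) measurableSet_Ioi]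
  have : (fun x : ℝ ↦ x + -(ξ * -(a.2 / r))) ⁻¹' Ioi 0 = Ioi (-(sideDist ξ a)) := by
    ext x
    simp only [mem_preimage, mem_Ioi, sideDist, ← hr]
    constructor <;> intro h <;> linarith
  rw [this, gaussianReal_real_Ioi, gaussInt_neg]
  ring

lemma integrable_gaussInt_sideDist (ξ : ℝ) :
    Integrable (fun p ↦ gaussInt (sideDist ξ p)) (relLaw ξ) :=
  Integrable.of_bound (continuous_gaussInt.measurable.comp
    (measurable_sideDist ξ)).aestronglyMeasurable (√(2 * Real.pi) / 2)
    (Filter.Eventually.of_forall fun _ ↦ abs_gaussInt_le _)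

lemma integrable_gaussInt_sideDist_sq (ξ : ℝ) :
    Integrable (fun p ↦ gaussInt (sideDist ξ p) ^ 2) (relLaw ξ) :=
  Integrable.of_bound ((continuous_gaussInt.measurable.comp
    (measurable_sideDist ξ)).pow_const 2).aestronglyMeasurable ((√(2 * Real.pi) / 2) ^ 2)
    (Filter.Eventually.of_forall fun _ ↦ by
      rw [norm_pow]; exact pow_le_pow_left₀ (norm_nonneg _) (abs_gaussInt_le _) 2)

/-- The reflection in the first axis preserves the law and changes the sign of `sideDist`. -/
lemma integral_gaussInt_sideDist (ξ : ℝ) : ∫ p, gaussInt (sideDist ξ p) ∂(relLaw ξ) = 0 := by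
  have h0 : MeasurePreserving (fun y : ℝ ↦ -y) (gaussianReal 0 1) (gaussianReal 0 1) :=
    ⟨measurable_neg, by rw [gaussianReal_map_neg, neg_zero]⟩
  have h : MeasurePreserving (Prod.map id fun y : ℝ ↦ -y) (relLaw ξ) (relLaw ξ) :=
    (MeasurePreserving.id _).prod h0
  have h1 : ∫ p, gaussInt (sideDist ξ p) ∂(relLaw ξ) =
      ∫ p, gaussInt (sideDist ξ (Prod.map id (fun y : ℝ ↦ -y) p)) ∂(relLaw ξ) := by
    have hm := (integrable_gaussInt_sideDist ξ).aestronglyMeasurable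
    rw [← h.map_eq] at hm
    rw [← integral_map h.measurable.aemeasurable hm, h.map_eq]
  have h2 : ∀ p : ℝ × ℝ, gaussInt (sideDist ξ (Prod.map id (fun y : ℝ ↦ -y) p)) =
      - gaussInt (sideDist ξ p) := by
    intro p
    rw [← gaussInt_neg]
    congr 1
    simp only [sideDist, Prod.map, id, neg_sq]
    ring
  simp only [h2, integral_neg] at h1
  linarith

lemma tripleLaw_real_bothLeft (ξ : ℝ) :
    (tripleLaw ξ).real bothLeft =
      1 / 4 + 1 / (2 * Real.pi) * ∫ p, gaussInt (sideDist ξ p) ^ 2 ∂(relLaw ξ) := by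
  have hs : √(2 * Real.pi) ^ 2 = 2 * Real.pi := Real.sq_sqrt (by positivity)
  have hs0 : (0 : ℝ) < √(2 * Real.pi) := by positivity
  rw [tripleLaw, real_prod_eq_integral _ _ measurableSet_bothLeft]
  have h : ∫ a, ((relLaw ξ).prod (relLaw ξ)).real (Prod.mk a ⁻¹' bothLeft) ∂(relLaw ξ) =
      ∫ a, (1 / 4 + (1 / √(2 * Real.pi) * gaussInt (sideDist ξ a) +
        1 / (2 * Real.pi) * gaussInt (sideDist ξ a) ^ 2)) ∂(relLaw ξ) := by
    apply integral_congr_ae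
    filter_upwards [ae_relLaw_fst_ne_zero ξ] with a ha
    have : (Prod.mk a ⁻¹' bothLeft) = {b | 0 < cross a b} ×ˢ {b | 0 < cross a b} := by
      ext ⟨b, c⟩; rfl
    rw [this, measureReal_prod_prod, relLaw_real_left ha]
    set g := gaussInt (sideDist ξ a)
    have h2 : g ^ 2 / (2 * Real.pi) = (g / √(2 * Real.pi)) ^ 2 := by rw [div_pow, hs]
    linear_combination -h2
  rw [h, integral_add (integrable_const _), integral_add, integral_const_mul, integral_const_mul,
    integral_gaussInt_sideDist]
  · simp
  · exact (integrable_gaussInt_sideDist ξ).const_mul _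
  · exact (integrable_gaussInt_sideDist_sq ξ).const_mul _
  · exact ((integrable_gaussInt_sideDist ξ).const_mul _).add
      ((integrable_gaussInt_sideDist_sq ξ).const_mul _)

lemma tripleLaw_real_cyclicTriples (ξ : ℝ) :
    (tripleLaw ξ).real cyclicTriples =
      1 / 4 - 3 / (2 * Real.pi) * ∫ p, gaussInt (sideDist ξ p) ^ 2 ∂(relLaw ξ) := by
  rw [tripleLaw_real_cyclicTriples_eq_bothLeft, tripleLaw_real_bothLeft]
  ring

/-! ### Polar coordinates -/

lemma tendsto_gaussInt_atTop :
    Filter.Tendsto gaussInt Filter.atTop (nhds (√(2 * Real.pi) / 2)) := by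
  rw [← integral_Ioi_zero_exp_neg_sq_div_two]
  exact intervalIntegral_tendsto_integral_Ioi 0 integrable_exp_neg_sq_div_two.integrableOn
    Filter.tendsto_id

/-- The integral of `r exp (-(r + t)² / 2)` over `r > 0`. -/
noncomputable def radialWeight (t : ℝ) : ℝ :=
  Real.exp (-t ^ 2 / 2) + t * gaussInt t - t * (√(2 * Real.pi) / 2)

@[fun_prop]
lemma continuous_radialWeight : Continuous radialWeight := by
  unfold radialWeight; fun_prop

lemma hasDerivAt_radial_primitive (t r : ℝ) :
    HasDerivAt (fun r ↦ -Real.exp (-(r + t) ^ 2 / 2) - t * gaussInt (r + t))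
      (r * Real.exp (-(r + t) ^ 2 / 2)) r := by
  have h1 : HasDerivAt (fun r : ℝ ↦ r + t) 1 r := (hasDerivAt_id r).add_const t
  have h2 := (((h1.pow 2).neg.div_const 2).exp.neg).sub
    (((hasDerivAt_gaussInt (r + t)).comp r h1).const_mul t)
  refine h2.congr_deriv ?_
  simp
  ring

lemma tendsto_radial_primitive (t : ℝ) :
    Filter.Tendsto (fun r ↦ -Real.exp (-(r + t) ^ 2 / 2) - t * gaussInt (r + t)) Filter.atTop
      (nhds (-0 - t * (√(2 * Real.pi) / 2))) := by
  have h1 : Filter.Tendsto (fun r : ℝ ↦ r + t) Filter.atTop Filter.atTop :=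
    Filter.tendsto_atTop_add_const_right _ t Filter.tendsto_id
  refine Filter.Tendsto.sub (Filter.Tendsto.neg ?_) ((tendsto_gaussInt_atTop.comp h1).const_mul t)
  refine Real.tendsto_exp_atBot.comp (Filter.Tendsto.atBot_div_const two_pos ?_)
  exact Filter.tendsto_neg_atTop_atBot.comp ((Filter.tendsto_pow_atTop two_ne_zero).comp h1)

lemma integrableOn_radial (t : ℝ) :
    IntegrableOn (fun r : ℝ ↦ r * Real.exp (-(r + t) ^ 2 / 2)) (Ioi 0) :=
  integrableOn_Ioi_deriv_of_nonneg' (fun r _ ↦ hasDerivAt_radial_primitive t r)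
    (fun _ hr ↦ mul_nonneg (le_of_lt hr) (Real.exp_pos _).le) (tendsto_radial_primitive t)

lemma integral_radial (t : ℝ) :
    ∫ r in Ioi (0 : ℝ), r * Real.exp (-(r + t) ^ 2 / 2) = radialWeight t := by
  rw [integral_Ioi_of_hasDerivAt_of_tendsto' (fun r _ ↦ hasDerivAt_radial_primitive t r)
    (integrableOn_radial t) (tendsto_radial_primitive t), radialWeight]
  simp only [zero_add]
  ring

lemma relLaw_eq_withDensity (ξ : ℝ) :
    relLaw ξ = (volume : Measure (ℝ × ℝ)).withDensity fun p ↦ ENNReal.ofReal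
      ((2 * Real.pi)⁻¹ * Real.exp (-((p.1 + ξ) ^ 2 + p.2 ^ 2) / 2)) := by
  rw [relLaw, gaussianReal_of_var_ne_zero _ one_ne_zero, gaussianReal_of_var_ne_zero _ one_ne_zero,
    prod_withDensity (measurable_gaussianPDF _ _) (measurable_gaussianPDF _ _),
    Measure.volume_eq_prod]
  congr 1 with p
  have hs : √(2 * Real.pi) * √(2 * Real.pi) = 2 * Real.pi := Real.mul_self_sqrt (by positivity)
  rw [gaussianPDF, gaussianPDF, ← ENNReal.ofReal_mul (gaussianPDFReal_nonneg _ _ _),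
    gaussianPDFReal_eq, gaussianPDFReal_eq, mul_mul_mul_comm, ← mul_inv, hs, ← Real.exp_add]
  congr 4
  ring

lemma integral_relLaw (ξ : ℝ) (f : ℝ × ℝ → ℝ) :
    ∫ p, f p ∂(relLaw ξ) =
      ∫ p, (2 * Real.pi)⁻¹ * Real.exp (-((p.1 + ξ) ^ 2 + p.2 ^ 2) / 2) * f p := by
  rw [relLaw_eq_withDensity, integral_withDensity_eq_integral_toReal_smul (by fun_prop)
    (Filter.Eventually.of_forall fun _ ↦ ENNReal.ofReal_lt_top)]
  congr 1 with p
  rw [ENNReal.toReal_ofReal (by positivity), smul_eq_mul]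

/-- The angular density of the law of a Gaussian vector with mean `(-ξ, 0)`. -/
noncomputable def angularWeight (ξ θ : ℝ) : ℝ :=
  Real.exp (-(ξ * Real.sin θ) ^ 2 / 2) * radialWeight (ξ * Real.cos θ)

@[fun_prop]
lemma continuous_angularWeight (ξ : ℝ) : Continuous (angularWeight ξ) := by
  unfold angularWeight; fun_prop

/-- The mean of a function of the signed distance, after integrating out the radius. -/
lemma integral_sideDist (ξ : ℝ) {g : ℝ → ℝ} (hg : Continuous g) :
    ∫ p, g (sideDist ξ p) ∂(relLaw ξ) =
      (2 * Real.pi)⁻¹ * ∫ θ in (-Real.pi)..Real.pi, angularWeight ξ θ * g (ξ * Real.sin θ) := by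
  have hpi := Real.pi_pos
  let F : ℝ × ℝ → ℝ := fun q ↦ (q.1 * Real.exp (-(q.1 + ξ * Real.cos q.2) ^ 2 / 2)) *
    ((2 * Real.pi)⁻¹ * (Real.exp (-(ξ * Real.sin q.2) ^ 2 / 2) * g (ξ * Real.sin q.2)))
  have hFc : Continuous F := by unfold F; fun_prop
  -- the integral of `‖F‖` over the radius is again explicit, and continuous in the angle
  have hFi : Integrable F ((volume.restrict (Ioi 0)).prod
      (volume.restrict (Ioo (-Real.pi) Real.pi))) := by
    rw [integrable_prod_iff' hFc.aestronglyMeasurable]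
    constructor
    · exact Filter.Eventually.of_forall fun θ ↦ Integrable.mul_const
        (integrableOn_radial (ξ * Real.cos θ))
        ((2 * Real.pi)⁻¹ * (Real.exp (-(ξ * Real.sin θ) ^ 2 / 2) * g (ξ * Real.sin θ)))
    · have : ∀ θ : ℝ, ∫ r in Ioi (0 : ℝ), ‖F (r, θ)‖ = radialWeight (ξ * Real.cos θ) *
          ‖(2 * Real.pi)⁻¹ * (Real.exp (-(ξ * Real.sin θ) ^ 2 / 2) * g (ξ * Real.sin θ))‖ := by
        intro θ
        rw [← integral_radial, ← integral_mul_const]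
        refine setIntegral_congr_fun measurableSet_Ioi fun r hr ↦ ?_
        simp only [F, norm_mul]
        congr 2
        · exact Real.norm_of_nonneg (le_of_lt hr)
        · exact Real.norm_of_nonneg (Real.exp_pos _).le
      simp only [this]
      have hc : Continuous fun θ : ℝ ↦ radialWeight (ξ * Real.cos θ) *
          ‖(2 * Real.pi)⁻¹ * (Real.exp (-(ξ * Real.sin θ) ^ 2 / 2) * g (ξ * Real.sin θ))‖ := by
        fun_prop
      exact (hc.integrableOn_Icc (a := -Real.pi) (b := Real.pi)).mono_set Ioo_subset_Icc_self
  rw [integral_relLaw, ← integral_comp_polarCoord_symm]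
  have h1 : ∫ q in polarCoord.target, q.1 • ((2 * Real.pi)⁻¹ *
      Real.exp (-(((polarCoord.symm q).1 + ξ) ^ 2 + (polarCoord.symm q).2 ^ 2) / 2) *
        g (sideDist ξ (polarCoord.symm q))) = ∫ q in polarCoord.target, F q := by
    refine setIntegral_congr_fun polarCoord.open_target.measurableSet fun q hq ↦ ?_
    have hr : 0 < q.1 := hq.1
    have hsc := Real.sin_sq_add_cos_sq q.2
    have hside : sideDist ξ (polarCoord.symm q) = ξ * Real.sin q.2 := by
      simp only [sideDist, polarCoord_symm_apply]
      rw [show (q.1 * Real.cos q.2) ^ 2 + (q.1 * Real.sin q.2) ^ 2 = q.1 ^ 2 by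
        linear_combination q.1 ^ 2 * hsc, Real.sqrt_sq hr.le]
      field_simp
    have hexp : Real.exp (-(((polarCoord.symm q).1 + ξ) ^ 2 + (polarCoord.symm q).2 ^ 2) / 2) =
        Real.exp (-(q.1 + ξ * Real.cos q.2) ^ 2 / 2) *
          Real.exp (-(ξ * Real.sin q.2) ^ 2 / 2) := by
      rw [← Real.exp_add]
      congr 1
      simp only [polarCoord_symm_apply]
      linear_combination (ξ ^ 2 / 2 - q.1 ^ 2 / 2) * hsc
    simp only [hside, hexp, F, smul_eq_mul]
    ring
  rw [h1, polarCoord_target, Measure.volume_eq_prod, ← Measure.prod_restrict,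
    integral_prod_symm _ hFi,
    intervalIntegral.integral_of_le (by linarith), integral_Ioc_eq_integral_Ioo,
    ← integral_const_mul]
  congr 1 with θ
  simp only [F, angularWeight]
  rw [integral_mul_const, integral_radial]
  ring

/-! ### The even moments of the signed distance -/

/-- The `2k`-th moment of the signed distance `sideDist ξ`. -/
noncomputable def distMoment (ξ : ℝ) (k : ℕ) : ℝ := ∫ p, sideDist ξ p ^ (2 * k) ∂(relLaw ξ)

/-- The mean of `(ξ sin θ) ^ (2k)` over a period. -/
noncomputable def sinMoment (ξ : ℝ) (k : ℕ) : ℝ :=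
  (2 * Real.pi)⁻¹ * ∫ θ in (-Real.pi)..Real.pi, (ξ * Real.sin θ) ^ (2 * k)

lemma sinMoment_zero (ξ : ℝ) : sinMoment ξ 0 = 1 := by
  have := Real.pi_pos
  simp only [sinMoment, mul_zero, pow_zero, intervalIntegral.integral_const, smul_eq_mul]
  field_simp
  ring

lemma sinMoment_succ (ξ : ℝ) (k : ℕ) :
    sinMoment ξ (k + 1) = ξ ^ 2 * ((2 * k + 1) / (2 * k + 2)) * sinMoment ξ k := by
  simp only [sinMoment, mul_pow, intervalIntegral.integral_const_mul]
  rw [show 2 * (k + 1) = 2 * k + 2 by ring, integral_sin_pow]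
  simp only [Real.sin_neg, Real.sin_pi, neg_zero, zero_pow (Nat.succ_ne_zero _), zero_mul, sub_zero,
    zero_div, zero_add]
  push_cast
  ring

/-- The part of `distMoment ξ k` that comes from the term `t * gaussInt t` of `radialWeight t`. -/
noncomputable def driftMoment (ξ : ℝ) (k : ℕ) : ℝ :=
  (2 * Real.pi)⁻¹ * ∫ θ in (-Real.pi)..Real.pi, (ξ * Real.sin θ) ^ (2 * k) *
    (ξ * Real.cos θ * gaussInt (ξ * Real.cos θ) * Real.exp (-(ξ * Real.sin θ) ^ 2 / 2))

lemma exp_sin_mul_exp_cos (ξ θ : ℝ) :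
    Real.exp (-(ξ * Real.sin θ) ^ 2 / 2) * Real.exp (-(ξ * Real.cos θ) ^ 2 / 2) =
      Real.exp (-ξ ^ 2 / 2) := by
  rw [← Real.exp_add]
  congr 1
  linear_combination (-ξ ^ 2 / 2) * Real.sin_sq_add_cos_sq θ

lemma hasDerivAt_mul_sin (ξ θ : ℝ) :
    HasDerivAt (fun θ ↦ ξ * Real.sin θ) (ξ * Real.cos θ) θ :=
  (Real.hasDerivAt_sin θ).const_mul ξ

lemma hasDerivAt_mul_cos (ξ θ : ℝ) :
    HasDerivAt (fun θ ↦ ξ * Real.cos θ) (-(ξ * Real.sin θ)) θ :=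
  ((Real.hasDerivAt_cos θ).const_mul ξ).congr_deriv (by ring)

/-- The integrand is the derivative of a function of `sin θ`. -/
lemma integral_cos_mul_sin_pow_mul_exp (ξ : ℝ) (k : ℕ) :
    ∫ θ in (-Real.pi)..Real.pi, (ξ * Real.sin θ) ^ (2 * k) *
      Real.exp (-(ξ * Real.sin θ) ^ 2 / 2) * (ξ * Real.cos θ) = 0 := by
  have hc : Continuous fun u : ℝ ↦ u ^ (2 * k) * Real.exp (-u ^ 2 / 2) := by fun_prop
  have h := intervalIntegral.integral_comp_mul_deriv (a := -Real.pi) (b := Real.pi)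
    (g := fun u : ℝ ↦ u ^ (2 * k) * Real.exp (-u ^ 2 / 2))
    (fun θ _ ↦ hasDerivAt_mul_sin ξ θ) (by fun_prop) hc
  simp only [Function.comp_def, Real.sin_neg, Real.sin_pi, neg_zero, mul_zero,
    intervalIntegral.integral_same] at h
  exact h

lemma distMoment_eq (ξ : ℝ) (k : ℕ) :
    distMoment ξ k = Real.exp (-ξ ^ 2 / 2) * sinMoment ξ k + driftMoment ξ k := by
  have h0 := integral_cos_mul_sin_pow_mul_exp ξ k
  have h := integral_sideDist ξ (g := fun x ↦ x ^ (2 * k)) (by fun_prop)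
  have h1 : ∀ θ : ℝ, angularWeight ξ θ * (ξ * Real.sin θ) ^ (2 * k) =
      (Real.exp (-ξ ^ 2 / 2) * (ξ * Real.sin θ) ^ (2 * k) + (ξ * Real.sin θ) ^ (2 * k) *
      (ξ * Real.cos θ * gaussInt (ξ * Real.cos θ) * Real.exp (-(ξ * Real.sin θ) ^ 2 / 2))) -
      √(2 * Real.pi) / 2 * ((ξ * Real.sin θ) ^ (2 * k) *
        Real.exp (-(ξ * Real.sin θ) ^ 2 / 2) * (ξ * Real.cos θ)) := by
    intro θ
    rw [angularWeight, radialWeight, ← exp_sin_mul_exp_cos ξ θ]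
    ring
  rw [distMoment, h]
  simp only [h1]
  rw [intervalIntegral.integral_sub, intervalIntegral.integral_add,
    intervalIntegral.integral_const_mul, intervalIntegral.integral_const_mul, h0, sinMoment,
    driftMoment]
  · ring
  all_goals exact Continuous.intervalIntegrable (by fun_prop) _ _

/-- Integration by parts over a period. -/
lemma driftMoment_succ (ξ : ℝ) (k : ℕ) :
    driftMoment ξ (k + 1) =
      (2 * k + 1) * driftMoment ξ k - Real.exp (-ξ ^ 2 / 2) * sinMoment ξ (k + 1) := by
  have hd : ∀ θ : ℝ, HasDerivAt (fun θ ↦ (ξ * Real.sin θ) ^ (2 * k + 1) *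
      Real.exp (-(ξ * Real.sin θ) ^ 2 / 2) * gaussInt (ξ * Real.cos θ))
      (((2 * k + 1) * ((ξ * Real.sin θ) ^ (2 * k) *
        (ξ * Real.cos θ * gaussInt (ξ * Real.cos θ) * Real.exp (-(ξ * Real.sin θ) ^ 2 / 2))) -
      Real.exp (-ξ ^ 2 / 2) * (ξ * Real.sin θ) ^ (2 * (k + 1))) -
      (ξ * Real.sin θ) ^ (2 * (k + 1)) * (ξ * Real.cos θ * gaussInt (ξ * Real.cos θ) *
        Real.exp (-(ξ * Real.sin θ) ^ 2 / 2))) θ := by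
    intro θ
    have h1 := hasDerivAt_mul_sin ξ θ
    have h2 := hasDerivAt_mul_cos ξ θ
    have h3 := ((h1.pow (2 * k + 1)).mul ((h1.pow 2).neg.div_const 2).exp).mul
      ((hasDerivAt_gaussInt (ξ * Real.cos θ)).comp θ h2)
    refine h3.congr_deriv ?_
    simp only [← exp_sin_mul_exp_cos ξ θ, Function.comp_def, Pi.mul_apply, Pi.neg_apply,
      Pi.pow_apply, Nat.add_sub_cancel]
    push_cast
    ring
  have h := intervalIntegral.integral_eq_sub_of_hasDerivAt (a := -Real.pi) (b := Real.pi)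
    (fun θ _ ↦ hd θ) (Continuous.intervalIntegrable (by fun_prop) _ _)
  rw [intervalIntegral.integral_sub, intervalIntegral.integral_sub,
    intervalIntegral.integral_const_mul, intervalIntegral.integral_const_mul] at h
  · simp only [Real.sin_neg, Real.sin_pi, neg_zero, mul_zero, zero_pow (Nat.succ_ne_zero _),
      zero_mul, sub_zero] at h
    simp only [driftMoment, sinMoment]
    linear_combination -(2 * Real.pi)⁻¹ * h
  all_goals exact Continuous.intervalIntegrable (by fun_prop) _ _

lemma distMoment_zero (ξ : ℝ) : distMoment ξ 0 = 1 := by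
  simp [distMoment]

/-- Iterating this gives `1 · 3 ⋯ (2k - 1)` times the probability that a Poisson variable of mean
`ξ² / 2` is at least `k`. -/
lemma distMoment_succ (ξ : ℝ) (k : ℕ) :
    distMoment ξ (k + 1) =
      (2 * k + 1) * (distMoment ξ k - Real.exp (-ξ ^ 2 / 2) * sinMoment ξ k) := by
  rw [distMoment_eq, distMoment_eq, driftMoment_succ]
  ring

/-! ### Rational approximation of the capture probability -/

/-- The coefficient of `x ^ (2m + 1)` in the Taylor series of `gaussInt`. -/
def taylorCoeff (m : ℕ) : ℚ := (-1) ^ m / (2 ^ m * m.factorial * (2 * m + 1))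

/-- The product of the odd numbers below `2k`. -/
def oddFact : ℕ → ℚ
  | 0 => 1
  | k + 1 => (2 * k + 1) * oddFact k

/-- The value of `sinMoment ξ`, for `y = ξ² / 2`. -/
def sinCoeff (y : ℚ) : ℕ → ℚ
  | 0 => 1
  | k + 1 => y * ((2 * k + 1) / (k + 1)) * sinCoeff y k

/-- The factor of `exp (-y)` in `oddFact k - distMoment ξ k`, for `y = ξ² / 2`. -/
def expCoeff (y : ℚ) : ℕ → ℚ
  | 0 => 0
  | k + 1 => (2 * k + 1) * (expCoeff y k + sinCoeff y k)

/-- The result of substituting `f k` for `x ^ (2k)` in the square of the Taylor polynomial of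
`gaussInt` with `n` terms. -/
def squareSubst (n : ℕ) (f : ℕ → ℚ) : ℚ :=
  ∑ i ∈ Finset.range n, ∑ j ∈ Finset.range n, taylorCoeff i * taylorCoeff j * f (i + j + 1)

/-- The Taylor polynomial of `exp` with `n` terms. -/
def expTaylor (n : ℕ) (x : ℚ) : ℚ := ∑ m ∈ Finset.range n, x ^ m / m.factorial

lemma sinMoment_eq_sinCoeff (ξ : ℝ) (y : ℚ) (hy : ξ ^ 2 / 2 = y) (k : ℕ) :
    sinMoment ξ k = sinCoeff y k := by
  induction k with
  | zero => simp [sinMoment_zero, sinCoeff]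
  | succ k ih =>
    have : ξ ^ 2 = 2 * y := by linarith
    rw [sinMoment_succ, ih, sinCoeff, this]
    push_cast
    field_simp

lemma distMoment_eq_sub (ξ : ℝ) (y : ℚ) (hy : ξ ^ 2 / 2 = y) (k : ℕ) :
    distMoment ξ k = oddFact k - expCoeff y k * Real.exp (-y) := by
  have he : Real.exp (-ξ ^ 2 / 2) = Real.exp (-y) := by rw [← hy]; congr 1; ring
  induction k with
  | zero => simp [distMoment_zero, oddFact, expCoeff]
  | succ k ih =>
    rw [distMoment_succ, ih, sinMoment_eq_sinCoeff ξ y hy, oddFact, expCoeff, he]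
    push_cast
    ring

lemma abs_exp_sub_expTaylor_le (x : ℝ) (n : ℕ) (hx : |x| / n.succ ≤ 1 / 2) :
    |Real.exp x - ∑ m ∈ Finset.range n, x ^ m / m.factorial| ≤ |x| ^ n / n.factorial * 2 := by
  have h := Complex.exp_bound' (x := (x : ℂ)) (n := n)
    (by rwa [Complex.norm_real, Real.norm_eq_abs])
  rw [Complex.norm_real, Real.norm_eq_abs] at h
  rw [← Real.norm_eq_abs, ← Complex.norm_real]
  push_cast
  exact h

/-- The Taylor polynomial of `gaussInt` with `n` terms. -/
noncomputable def gaussTaylor (n : ℕ) (x : ℝ) : ℝ :=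
  ∑ m ∈ Finset.range n, (taylorCoeff m : ℝ) * x ^ (2 * m + 1)

lemma integral_sum_eq_gaussTaylor (n : ℕ) (x : ℝ) :
    ∫ u in (0 : ℝ)..x, ∑ m ∈ Finset.range n, (-u ^ 2 / 2) ^ m / m.factorial = gaussTaylor n x := by
  rw [intervalIntegral.integral_finsetSum
    (fun m _ ↦ Continuous.intervalIntegrable (by fun_prop) _ _), gaussTaylor]
  refine Finset.sum_congr rfl fun m _ ↦ ?_
  have : ∀ u : ℝ, (-u ^ 2 / 2) ^ m / m.factorial =
      (-1) ^ m / (2 ^ m * m.factorial) * u ^ (2 * m) := by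
    intro u
    rw [div_pow, neg_pow, ← pow_mul]
    field_simp
  simp only [this]
  rw [intervalIntegral.integral_const_mul, integral_pow, taylorCoeff]
  push_cast
  simp only [ne_eq, Nat.add_eq_zero_iff, one_ne_zero, and_false, not_false_eq_true, zero_pow,
    sub_zero]
  field_simp

lemma abs_gaussInt_sub_gaussTaylor_le {x : ℝ} (hx : |x| ≤ 2) {n : ℕ} (hn : 3 ≤ n) :
    |gaussInt x - gaussTaylor n x| ≤ 2 ^ n / n.factorial * 4 := by
  rw [← integral_sum_eq_gaussTaylor, gaussInt, ← intervalIntegral.integral_sub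
    (Continuous.intervalIntegrable (by fun_prop) _ _)
    (Continuous.intervalIntegrable (by fun_prop) _ _)]
  have h : ∀ u ∈ Set.uIoc 0 x, ‖Real.exp (-u ^ 2 / 2) -
      ∑ m ∈ Finset.range n, (-u ^ 2 / 2) ^ m / m.factorial‖ ≤ 2 ^ n / n.factorial * 2 := by
    intro u hu
    have hu2 : |u| ≤ 2 := by
      have : |u| ≤ |x| := by
        rcases Set.mem_uIoc.1 hu with ⟨h1, h2⟩ | ⟨h1, h2⟩
        · rw [abs_of_pos h1]; exact h2.trans (le_abs_self x)
        · rw [abs_of_nonpos h2]; exact (by linarith : -u ≤ -x).trans (neg_le_abs x)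
      exact this.trans hx
    have hsq : |-u ^ 2 / 2| ≤ 2 := by
      rw [abs_div, abs_neg, abs_pow, abs_two]
      nlinarith [abs_nonneg u]
    have hn' : (4 : ℝ) ≤ n.succ := by exact_mod_cast Nat.succ_le_succ hn
    refine (abs_exp_sub_expTaylor_le _ n ?_).trans ?_
    · rw [div_le_iff₀ (by linarith)]; linarith
    · gcongr
  refine (intervalIntegral.norm_integral_le_of_norm_le_const h).trans ?_
  rw [sub_zero]
  calc 2 ^ n / (n.factorial : ℝ) * 2 * |x| ≤ 2 ^ n / n.factorial * 2 * 2 := by gcongr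
    _ = 2 ^ n / n.factorial * 4 := by ring

lemma abs_sideDist_le (ξ : ℝ) (p : ℝ × ℝ) : |sideDist ξ p| ≤ |ξ| := by
  rw [sideDist, abs_mul, abs_div, abs_of_nonneg (Real.sqrt_nonneg _)]
  refine mul_le_of_le_one_right (abs_nonneg _) (div_le_one_of_le₀ ?_ (Real.sqrt_nonneg _))
  exact Real.abs_le_sqrt (by nlinarith [sq_nonneg p.1])

lemma integrable_sideDist_pow (ξ : ℝ) (k : ℕ) :
    Integrable (fun p ↦ sideDist ξ p ^ k) (relLaw ξ) :=
  Integrable.of_bound ((measurable_sideDist ξ).pow_const k).aestronglyMeasurable (|ξ| ^ k)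
    (Filter.Eventually.of_forall fun p ↦ by
      rw [norm_pow]; exact pow_le_pow_left₀ (norm_nonneg _) (abs_sideDist_le ξ p) k)

lemma gaussTaylor_sq (n : ℕ) (x : ℝ) :
    gaussTaylor n x ^ 2 = ∑ i ∈ Finset.range n, ∑ j ∈ Finset.range n,
      ((taylorCoeff i : ℝ) * taylorCoeff j) * x ^ (2 * (i + j + 1)) := by
  rw [sq, gaussTaylor, Finset.sum_mul_sum]
  refine Finset.sum_congr rfl fun i _ ↦ Finset.sum_congr rfl fun j _ ↦ ?_
  ring

lemma integrable_gaussTaylor_sideDist_sq (ξ : ℝ) (n : ℕ) :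
    Integrable (fun p ↦ gaussTaylor n (sideDist ξ p) ^ 2) (relLaw ξ) := by
  simp only [gaussTaylor_sq]
  exact integrable_finsetSum _ fun i _ ↦ integrable_finsetSum _ fun j _ ↦
    (integrable_sideDist_pow ξ _).const_mul _

lemma integral_gaussTaylor_sideDist_sq (ξ : ℝ) (y : ℚ) (hy : ξ ^ 2 / 2 = y) (n : ℕ) :
    ∫ p, gaussTaylor n (sideDist ξ p) ^ 2 ∂(relLaw ξ) =
      squareSubst n oddFact - squareSubst n (expCoeff y) * Real.exp (-y) := by
  simp only [gaussTaylor_sq]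
  rw [integral_finsetSum _ fun i _ ↦ integrable_finsetSum _ fun j _ ↦
    (integrable_sideDist_pow ξ _).const_mul _]
  simp only [squareSubst]
  push_cast
  rw [Finset.sum_mul, ← Finset.sum_sub_distrib]
  refine Finset.sum_congr rfl fun i _ ↦ ?_
  rw [integral_finsetSum _ fun j _ ↦ (integrable_sideDist_pow ξ _).const_mul _,
    Finset.sum_mul, ← Finset.sum_sub_distrib]
  refine Finset.sum_congr rfl fun j _ ↦ ?_
  rw [integral_const_mul]
  have := distMoment_eq_sub ξ y hy (i + j + 1)
  rw [distMoment] at this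
  rw [this]
  ring

lemma abs_integral_sub_le {ξ : ℝ} (hξ : |ξ| ≤ 2) (y : ℚ) (hy : ξ ^ 2 / 2 = y) {n : ℕ}
    (hn : 3 ≤ n) (hn1 : (2 : ℝ) ^ n / n.factorial * 4 ≤ 1) :
    |∫ p, gaussInt (sideDist ξ p) ^ 2 ∂(relLaw ξ) -
      (squareSubst n oddFact - squareSubst n (expCoeff y) * Real.exp (-y))| ≤
        2 ^ n / n.factorial * 20 := by
  rw [← integral_gaussTaylor_sideDist_sq ξ y hy, ← integral_sub
    (integrable_gaussInt_sideDist_sq ξ) (integrable_gaussTaylor_sideDist_sq ξ n)]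
  have h : ∀ p, ‖gaussInt (sideDist ξ p) ^ 2 - gaussTaylor n (sideDist ξ p) ^ 2‖ ≤
      2 ^ n / n.factorial * 20 := by
    intro p
    have hd := (abs_sideDist_le ξ p).trans hξ
    have h1 := abs_gaussInt_sub_gaussTaylor_le hd hn
    have h2 := (abs_gaussInt_le_abs (sideDist ξ p)).trans hd
    set s := gaussInt (sideDist ξ p)
    set t := gaussTaylor n (sideDist ξ p)
    have h3 : |s + t| ≤ 5 := by
      rw [show s + t = 2 * s - (s - t) by ring]
      refine (abs_sub _ _).trans ?_
      rw [abs_mul, abs_two]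
      linarith
    rw [Real.norm_eq_abs, show s ^ 2 - t ^ 2 = (s - t) * (s + t) by ring, abs_mul]
    calc |s - t| * |s + t| ≤ (2 ^ n / n.factorial * 4) * 5 := by gcongr
      _ = _ := by ring
  have h2 := norm_integral_le_of_norm_le_const (μ := relLaw ξ) (Filter.Eventually.of_forall h)
  simpa using h2

/-- The value of `squareSubst 20` on the moments of `sideDist ξ`, with `e` in place of
`exp (-ξ² / 2)` and `y = ξ² / 2`. -/
def approxMean (y e : ℚ) : ℚ := squareSubst 20 oddFact - squareSubst 20 (expCoeff y) * e

lemma mul_mem_of_mem_Icc {b e e₁ e₂ m M : ℝ} (h1 : e₁ ≤ e) (h2 : e ≤ e₂)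
    (hm : m ≤ b * e₁ ∧ m ≤ b * e₂) (hM : b * e₁ ≤ M ∧ b * e₂ ≤ M) :
    m ≤ b * e ∧ b * e ≤ M := by
  rcases le_total 0 b with hb | hb
  · exact ⟨hm.1.trans (mul_le_mul_of_nonneg_left h1 hb),
      (mul_le_mul_of_nonneg_left h2 hb).trans hM.2⟩
  · exact ⟨hm.2.trans (mul_le_mul_of_nonpos_left h2 hb),
      (mul_le_mul_of_nonpos_left h1 hb).trans hM.1⟩

/-- A lower bound for `exp (-y)` when `0 ≤ y ≤ 2`. -/
def expLower (y : ℚ) : ℚ := expTaylor 80 (-y) - y ^ 80 / Nat.factorial 80 * 2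

/-- An upper bound for `exp (-y)` when `0 ≤ y ≤ 2`. -/
def expUpper (y : ℚ) : ℚ := expTaylor 80 (-y) + y ^ 80 / Nat.factorial 80 * 2

/-- A rational test for the mean of `gaussInt (sideDist ξ) ^ 2` to lie in `[m, M]`. The value
`α - β exp (-y)` is affine in `exp (-y)`, so that it suffices to bound it at the two ends of an
interval containing `exp (-y)`. -/
lemma integral_gaussInt_sideDist_sq_mem_Icc {ξ : ℝ} (hξ : |ξ| ≤ 2) (y : ℚ) (hy : ξ ^ 2 / 2 = y)
    {m M : ℚ} (hm : m + 1 / 10 ^ 10 ≤ min (approxMean y (expLower y)) (approxMean y (expUpper y)))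
    (hM : max (approxMean y (expLower y)) (approxMean y (expUpper y)) + 1 / 10 ^ 10 ≤ M) :
    ∫ p, gaussInt (sideDist ξ p) ^ 2 ∂(relLaw ξ) ∈ Icc (m : ℝ) M := by
  -- the error of the Taylor polynomial with `20` terms, which the margin `1 / 10 ^ 10` absorbs
  have hfact : (2 : ℝ) ^ 20 / (Nat.factorial 20) * 20 ≤ 1 / 10 ^ 10 := by
    norm_num [Nat.factorial]
  have hV := abs_le.1 ((abs_integral_sub_le hξ y hy (n := 20) (by norm_num)
    (by norm_num [Nat.factorial])).trans hfact)
  have hy2 : |(-(y : ℝ))| ≤ 2 := by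
    rw [← hy, abs_neg, abs_div, abs_pow, abs_two]
    nlinarith [abs_nonneg ξ]
  have hy0 : (0 : ℝ) ≤ y := by rw [← hy]; positivity
  have hexp := abs_le.1 (abs_exp_sub_expTaylor_le (-(y : ℝ)) 80 (by
    rw [div_le_iff₀ (by positivity)]; push_cast; linarith))
  rw [abs_neg, abs_of_nonneg hy0] at hexp
  have hc : ((expTaylor 80 (-y) : ℚ) : ℝ) =
      ∑ m ∈ Finset.range 80, (-(y : ℝ)) ^ m / (m.factorial : ℝ) := by
    simp only [expTaylor]
    push_cast
    rfl
  rw [← hc] at hexp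
  have h1 : (expLower y : ℝ) ≤ Real.exp (-y) := by
    rw [expLower]
    simp only [Rat.cast_sub, Rat.cast_mul, Rat.cast_div, Rat.cast_pow, Rat.cast_natCast,
      Rat.cast_ofNat]
    linarith [hexp.1]
  have h2 : Real.exp (-y) ≤ (expUpper y : ℝ) := by
    rw [expUpper]
    simp only [Rat.cast_add, Rat.cast_mul, Rat.cast_div, Rat.cast_pow, Rat.cast_natCast,
      Rat.cast_ofNat]
    linarith [hexp.2]
  obtain ⟨hm1, hm2⟩ := le_min_iff.1 hm
  obtain ⟨hM1, hM2⟩ := max_le_iff.1 ((le_sub_iff_add_le).2 hM)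
  simp only [approxMean] at hm1 hm2 hM1 hM2
  generalize expLower y = e₁ at *
  generalize expUpper y = e₂ at *
  generalize squareSubst 20 oddFact = α at *
  generalize squareSubst 20 (expCoeff y) = β at *
  have hm1' : (m : ℝ) + 1 / 10 ^ 10 ≤ α - β * e₁ := by
    have := (Rat.cast_le (K := ℝ)).2 hm1
    push_cast at this
    exact this
  have hm2' : (m : ℝ) + 1 / 10 ^ 10 ≤ α - β * e₂ := by
    have := (Rat.cast_le (K := ℝ)).2 hm2
    push_cast at this
    exact this
  have hM1' : (α : ℝ) - β * e₁ ≤ M - 1 / 10 ^ 10 := by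
    have := (Rat.cast_le (K := ℝ)).2 hM1
    push_cast at this
    exact this
  have hM2' : (α : ℝ) - β * e₂ ≤ M - 1 / 10 ^ 10 := by
    have := (Rat.cast_le (K := ℝ)).2 hM2
    push_cast at this
    exact this
  -- the sign of `β` plays no role: a linear function lies between its values at the two ends
  have hb := mul_mem_of_mem_Icc (b := (β : ℝ)) (m := α - M + 1 / 10 ^ 10)
    (M := α - m - 1 / 10 ^ 10) h1 h2 ⟨by linarith, by linarith⟩ ⟨by linarith, by linarith⟩
  constructor
  · linarith [hV.1, hb.2]
  · linarith [hV.2, hb.1]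

/-- The test for the mean, combined with rational bounds for `π`. -/
lemma tripleLaw_real_mem_Ico {ξ : ℝ} (hξ : |ξ| ≤ 2) (y : ℚ) (hy : ξ ^ 2 / 2 = y)
    {m M l u : ℚ}
    (hm : m + 1 / 10 ^ 10 ≤ min (approxMean y (expLower y)) (approxMean y (expUpper y)))
    (hM : max (approxMean y (expLower y)) (approxMean y (expUpper y)) + 1 / 10 ^ 10 ≤ M)
    (hl : l ≤ 1 / 4) (hu : u ≤ 1 / 4)
    (hlM : M ≤ (1 / 4 - l) * (2 * (314159265358979323846 / 10 ^ 20)) / 3)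
    (hum : (1 / 4 - u) * (2 * (314159265358979323847 / 10 ^ 20)) / 3 < m) :
    (tripleLaw ξ).real cyclicTriples ∈ Ico (l : ℝ) u := by
  have hV := integral_gaussInt_sideDist_sq_mem_Icc hξ y hy hm hM
  rw [tripleLaw_real_cyclicTriples]
  set V := ∫ p, gaussInt (sideDist ξ p) ^ 2 ∂(relLaw ξ)
  have hpi := Real.pi_pos
  have hp1 := Real.pi_gt_d20
  have hp2 := Real.pi_lt_d20
  have hl' : (l : ℝ) ≤ 1 / 4 := by
    have := (Rat.cast_le (K := ℝ)).2 hl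
    push_cast at this
    exact this
  have hu' : (u : ℝ) ≤ 1 / 4 := by
    have := (Rat.cast_le (K := ℝ)).2 hu
    push_cast at this
    exact this
  have hlM' : (M : ℝ) ≤ (1 / 4 - l) * (2 * 3.14159265358979323846) / 3 := by
    have := (Rat.cast_le (K := ℝ)).2 hlM
    push_cast at this
    linarith
  have hum' : (1 / 4 - (u : ℝ)) * (2 * 3.14159265358979323847) / 3 < m := by
    have := (Rat.cast_lt (K := ℝ)).2 hum
    push_cast at this
    linarith
  have h1 : V ≤ (1 / 4 - l) * (2 * Real.pi) / 3 := by
    have := mul_le_mul_of_nonneg_left hp1.le (sub_nonneg.2 hl')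
    linarith [hV.2]
  have h2 : (1 / 4 - u) * (2 * Real.pi) / 3 < V := by
    have := mul_le_mul_of_nonneg_left hp2.le (sub_nonneg.2 hu')
    linarith [hV.1]
  have h3 : 3 / (2 * Real.pi) * V = 3 * V / (2 * Real.pi) := by ring
  rw [h3]
  constructor
  · have : 3 * V / (2 * Real.pi) ≤ 1 / 4 - l := by
      rw [div_le_iff₀ (by positivity)]; linarith
    linarith
  · have : 1 / 4 - u < 3 * V / (2 * Real.pi) := by
      rw [lt_div_iff₀ (by positivity)]; linarith
    linarith

/-! ### The mean of a product of two normal distribution functions -/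

lemma integral_mul_exp_mul_gaussInt {c : ℝ} (hc : 0 < c) (β : ℝ) :
    ∫ z, z * Real.exp (-(c / 2) * z ^ 2) * gaussInt (β * z) =
      β / c * (√(2 * Real.pi) / √(c + β ^ 2)) := by
  have hu : ∀ z : ℝ, HasDerivAt (fun z ↦ gaussInt (β * z)) (β * Real.exp (-(β * z) ^ 2 / 2)) z := by
    intro z
    have h := (hasDerivAt_gaussInt (β * z)).comp z ((hasDerivAt_id z).const_mul β)
    exact h.congr_deriv (by ring)
  have hv : ∀ z : ℝ, HasDerivAt (fun z ↦ -(1 / c) * Real.exp (-(c / 2) * z ^ 2))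
      (z * Real.exp (-(c / 2) * z ^ 2)) z := by
    intro z
    have h := ((((hasDerivAt_id z).pow 2).const_mul (-(c / 2))).exp).const_mul (-(1 / c))
    refine h.congr_deriv ?_
    simp
    field_simp
  have hS : Continuous fun z ↦ gaussInt (β * z) := by fun_prop
  have hb : ∀ z, ‖gaussInt (β * z)‖ ≤ √(2 * Real.pi) / 2 := fun z ↦ abs_gaussInt_le _
  have hint := integrable_exp_neg_mul_sq (b := c / 2) (by positivity)
  have e : ∀ z : ℝ, β * Real.exp (-(β * z) ^ 2 / 2) * (-(1 / c) * Real.exp (-(c / 2) * z ^ 2)) =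
      -(β / c) * Real.exp (-((c + β ^ 2) / 2) * z ^ 2) := by
    intro z
    rw [show -((c + β ^ 2) / 2) * z ^ 2 = -(β * z) ^ 2 / 2 + -(c / 2) * z ^ 2 by ring, Real.exp_add]
    ring
  have hpos : 0 < c + β ^ 2 := by positivity
  have h := integral_mul_deriv_eq_deriv_mul_of_integrable (u := fun z ↦ gaussInt (β * z))
    (v := fun z ↦ -(1 / c) * Real.exp (-(c / 2) * z ^ 2)) (fun z _ ↦ hu z) (fun z _ ↦ hv z)
    ((integrable_mul_exp_neg_mul_sq (b := c / 2) (by positivity)).bdd_mul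
      hS.aestronglyMeasurable (Filter.Eventually.of_forall hb))
    (by
      change Integrable fun z : ℝ ↦
        β * Real.exp (-(β * z) ^ 2 / 2) * (-(1 / c) * Real.exp (-(c / 2) * z ^ 2))
      simp only [e]
      exact (integrable_exp_neg_mul_sq (by positivity)).const_mul _)
    ((hint.const_mul _).bdd_mul hS.aestronglyMeasurable (Filter.Eventually.of_forall hb))
  simp only [e] at h
  rw [integral_const_mul, integral_gaussian] at h
  simp only [mul_comm _ (gaussInt _)]
  rw [h, show Real.pi / ((c + β ^ 2) / 2) = 2 * Real.pi / (c + β ^ 2) by field_simp,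
    Real.sqrt_div' _ hpos.le]
  ring

lemma hasDerivAt_integral_gaussInt_mul (α β : ℝ) :
    HasDerivAt (fun α ↦ ∫ z, gaussInt (α * z) * gaussInt (β * z) ∂(gaussianReal 0 1))
      (β / ((1 + α ^ 2) * √(1 + α ^ 2 + β ^ 2))) α := by
  have hb : ∀ z, |gaussInt z| ≤ √(2 * Real.pi) / 2 := fun z ↦ abs_gaussInt_le _
  have hid : Integrable (fun z : ℝ ↦ |z|) (gaussianReal 0 1) :=
    ((memLp_id_gaussianReal 1).integrable le_rfl).abs
  have h := (hasDerivAt_integral_of_dominated_loc_of_deriv_le (μ := gaussianReal 0 1)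
    (s := univ) (x₀ := α) (F := fun α z ↦ gaussInt (α * z) * gaussInt (β * z))
    (F' := fun α z ↦ z * Real.exp (-(α * z) ^ 2 / 2) * gaussInt (β * z))
    (bound := fun z ↦ |z| * (√(2 * Real.pi) / 2)) Filter.univ_mem
    (Filter.Eventually.of_forall fun a ↦ Continuous.aestronglyMeasurable (by fun_prop))
    (Integrable.of_bound (Continuous.aestronglyMeasurable (by fun_prop))
      (√(2 * Real.pi) / 2 * (√(2 * Real.pi) / 2)) (Filter.Eventually.of_forall fun z ↦ by
        rw [norm_mul]
        exact mul_le_mul (hb _) (hb _) (norm_nonneg _) (by positivity)))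
    (Continuous.aestronglyMeasurable (by fun_prop))
    (Filter.Eventually.of_forall fun z a _ ↦ by
      rw [norm_mul, norm_mul, Real.norm_eq_abs, Real.norm_eq_abs, Real.norm_eq_abs, Real.abs_exp]
      refine mul_le_mul (mul_le_of_le_one_right (abs_nonneg z) ?_) (hb _) (abs_nonneg _)
        (abs_nonneg z)
      rw [Real.exp_le_one_iff]
      nlinarith [sq_nonneg (a * z)])
    (hid.mul_const _)
    (Filter.Eventually.of_forall fun z a _ ↦ by
      have h1 : HasDerivAt (fun a : ℝ ↦ a * z) z a := by
        simpa using (hasDerivAt_id a).mul_const z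
      have h2 := ((hasDerivAt_gaussInt (a * z)).comp a h1).mul_const (gaussInt (β * z))
      exact h2.congr_deriv (by ring))).2
  refine h.congr_deriv ?_
  rw [integral_gaussianReal_eq_integral_smul one_ne_zero]
  have e : ∀ z : ℝ, gaussianPDFReal 0 1 z •
      (z * Real.exp (-(α * z) ^ 2 / 2) * gaussInt (β * z)) =
      (√(2 * Real.pi))⁻¹ * (z * Real.exp (-((1 + α ^ 2) / 2) * z ^ 2) * gaussInt (β * z)) := by
    intro z
    rw [gaussianPDFReal_eq, smul_eq_mul,
      show -((1 + α ^ 2) / 2) * z ^ 2 = -(z - 0) ^ 2 / 2 + -(α * z) ^ 2 / 2 by ring, Real.exp_add]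
    ring
  simp only [e]
  rw [integral_const_mul, integral_mul_exp_mul_gaussInt (by positivity)]
  have hs : (0 : ℝ) < √(2 * Real.pi) := by positivity
  field_simp

lemma hasDerivAt_arctan_quadrant (α β : ℝ) :
    HasDerivAt (fun α ↦ Real.arctan (α * β / √(1 + α ^ 2 + β ^ 2)))
      (β / ((1 + α ^ 2) * √(1 + α ^ 2 + β ^ 2))) α := by
  have hpos : 0 < 1 + α ^ 2 + β ^ 2 := by positivity
  have hw : √(1 + α ^ 2 + β ^ 2) ^ 2 = 1 + α ^ 2 + β ^ 2 := Real.sq_sqrt hpos.le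
  have hw0 : 0 < √(1 + α ^ 2 + β ^ 2) := Real.sqrt_pos.2 hpos
  have h1 : HasDerivAt (fun α : ℝ ↦ 1 + α ^ 2 + β ^ 2) (2 * α) α := by
    have := (((hasDerivAt_id α).pow 2).const_add 1).add_const (β ^ 2)
    refine this.congr_deriv ?_
    simp
  have h2 := (((hasDerivAt_id α).mul_const β).div (h1.sqrt hpos.ne') hw0.ne').arctan
  refine h2.congr_deriv ?_
  simp only [id, Pi.div_apply]
  set w := √(1 + α ^ 2 + β ^ 2)
  have h3 : (1 + (α * β / w) ^ 2) = ((1 + α ^ 2) * (1 + β ^ 2)) / w ^ 2 := by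
    field_simp
    linear_combination hw
  rw [h3]
  field_simp
  linear_combination β * hw

/-- Sheppard's formula: both sides vanish at `α = 0` and have the same derivative in `α`. -/
lemma integral_gaussInt_mul_gaussInt (α β : ℝ) :
    ∫ z, gaussInt (α * z) * gaussInt (β * z) ∂(gaussianReal 0 1) =
      Real.arctan (α * β / √(1 + α ^ 2 + β ^ 2)) := by
  have h : ∀ a, HasDerivAt (fun α ↦ (∫ z, gaussInt (α * z) * gaussInt (β * z) ∂(gaussianReal 0 1)) -
      Real.arctan (α * β / √(1 + α ^ 2 + β ^ 2))) 0 a := by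
    intro a
    exact ((hasDerivAt_integral_gaussInt_mul a β).sub
      (hasDerivAt_arctan_quadrant a β)).congr_deriv (sub_self _)
  have h2 := is_const_of_deriv_eq_zero (fun a ↦ (h a).differentiableAt) (fun a ↦ (h a).deriv) α 0
  simp only [zero_mul, gaussInt_zero, integral_zero, zero_div, Real.arctan_zero, sub_zero] at h2
  linarith

lemma measureReal_opposite_sides (u v : ℝ) :
    ((gaussianReal 0 1).prod (gaussianReal 0 1)).real {p | 0 < (v - p.2) * (p.1 - u)} =
      1 / 2 - gaussInt u * gaussInt v / Real.pi := by
  have hs : {p : ℝ × ℝ | 0 < (v - p.2) * (p.1 - u)} = Ioi u ×ˢ Iio v ∪ Iio u ×ˢ Ioi v := by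
    ext p
    simp only [mem_ofPred_eq, mul_pos_iff, mem_union, mem_prod, mem_Ioi, mem_Iio, sub_pos, sub_neg]
    tauto
  have hd : Disjoint (Ioi u ×ˢ Iio v) (Iio u ×ˢ Ioi v) := by
    rw [Set.disjoint_left]
    rintro p ⟨h1, -⟩ ⟨h2, -⟩
    exact lt_asymm (mem_Ioi.1 h1) (mem_Iio.1 h2)
  rw [hs, measureReal_union hd (measurableSet_Iio.prod measurableSet_Ioi), measureReal_prod_prod,
    measureReal_prod_prod, gaussianReal_real_Ioi, gaussianReal_real_Ioi, gaussianReal_real_Iio,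
    gaussianReal_real_Iio]
  have h2 : √(2 * Real.pi) ^ 2 = 2 * Real.pi := Real.sq_sqrt (by positivity)
  have h3 : gaussInt u / √(2 * Real.pi) * (gaussInt v / √(2 * Real.pi)) =
      gaussInt u * gaussInt v / (2 * Real.pi) := by
    rw [div_mul_div_comm, ← sq, h2]
  linear_combination -2 * h3

/-- For independent standard normal `z`, `x`, `y`, the probability that `x - α z` and `β z - y` have
the same sign. -/
lemma measureReal_crossing (α β : ℝ) :
    ((gaussianReal 0 1).prod ((gaussianReal 0 1).prod (gaussianReal 0 1))).real
      {q | 0 < (β * q.1 - q.2.2) * (q.2.1 - α * q.1)} =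
      1 / 2 - Real.arctan (α * β / √(1 + α ^ 2 + β ^ 2)) / Real.pi := by
  have hm : MeasurableSet {q : ℝ × ℝ × ℝ | 0 < (β * q.1 - q.2.2) * (q.2.1 - α * q.1)} :=
    measurableSet_lt (by fun_prop) (by fun_prop)
  rw [real_prod_eq_integral _ _ hm, ← integral_gaussInt_mul_gaussInt]
  have h : ∀ z : ℝ, ((gaussianReal 0 1).prod (gaussianReal 0 1)).real
      (Prod.mk z ⁻¹' {q : ℝ × ℝ × ℝ | 0 < (β * q.1 - q.2.2) * (q.2.1 - α * q.1)}) =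
      1 / 2 - gaussInt (α * z) * gaussInt (β * z) / Real.pi :=
    fun z ↦ measureReal_opposite_sides (α * z) (β * z)
  simp only [h]
  rw [integral_sub (integrable_const _), integral_const, probReal_univ, one_smul, integral_div]
  refine Integrable.div_const (Integrable.of_bound
    (Continuous.aestronglyMeasurable (by fun_prop)) (√(2 * Real.pi) / 2 * (√(2 * Real.pi) / 2))
    (Filter.Eventually.of_forall fun z ↦ ?_)) _
  rw [norm_mul]
  exact mul_le_mul (abs_gaussInt_le _) (abs_gaussInt_le _) (norm_nonneg _) (by positivity)

/-! ### Separating the two coordinates of the vertices -/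

lemma measurePreserving_prodProdProdComm {α β γ δ : Type*} [MeasurableSpace α] [MeasurableSpace β]
    [MeasurableSpace γ] [MeasurableSpace δ] (μa : Measure α) (μb : Measure β) (μc : Measure γ)
    (μd : Measure δ) [SigmaFinite μa] [SigmaFinite μb] [SigmaFinite μc] [SigmaFinite μd] :
    MeasurePreserving (fun p : (α × β) × (γ × δ) ↦ ((p.1.1, p.2.1), (p.1.2, p.2.2)))
      ((μa.prod μb).prod (μc.prod μd)) ((μa.prod μc).prod (μb.prod μd)) := by
  have h1 := measurePreserving_prodAssoc μa μb (μc.prod μd)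
  have h2 : MeasurePreserving (fun p : β × γ × δ ↦ (p.2.1, p.1, p.2.2))
      (μb.prod (μc.prod μd)) (μc.prod (μb.prod μd)) :=
    (measurePreserving_prodAssoc μc μb μd).comp
      ((Measure.measurePreserving_swap.prod (MeasurePreserving.id μd)).comp
        ((measurePreserving_prodAssoc μb μc μd).symm _))
  have h3 := (measurePreserving_prodAssoc μa μc (μb.prod μd)).symm _
  exact h3.comp (((MeasurePreserving.id μa).prod h2).comp h1)

/-- The law of the first coordinates of the three vertices. -/
noncomputable def firstLaw (ξ : ℝ) : Measure (ℝ × ℝ × ℝ) :=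
  (gaussianReal (-ξ) 1).prod ((gaussianReal (-ξ) 1).prod (gaussianReal (-ξ) 1))

instance (ξ : ℝ) : IsProbabilityMeasure (firstLaw ξ) := by
  unfold firstLaw; infer_instance

/-- The second coordinates are listed starting with that of the last vertex. -/
lemma measurePreserving_join (ξ : ℝ) :
    MeasurePreserving (fun q : (ℝ × ℝ × ℝ) × (ℝ × ℝ × ℝ) ↦
      ((q.1.1, q.2.2.1), (q.1.2.1, q.2.2.2), (q.1.2.2, q.2.1)))
      ((firstLaw ξ).prod ((gaussianReal 0 1).prod ((gaussianReal 0 1).prod (gaussianReal 0 1))))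
      (tripleLaw ξ) := by
  have hrot : MeasurePreserving (fun p : ℝ × ℝ × ℝ ↦ (p.2.1, p.2.2, p.1))
      ((gaussianReal 0 1).prod ((gaussianReal 0 1).prod (gaussianReal 0 1)))
      ((gaussianReal 0 1).prod ((gaussianReal 0 1).prod (gaussianReal 0 1))) :=
    (measurePreserving_prodAssoc _ _ _).comp Measure.measurePreserving_swap
  have h1 := (MeasurePreserving.id (firstLaw ξ)).prod hrot
  have h2 := measurePreserving_prodProdProdComm (gaussianReal (-ξ) 1)
    ((gaussianReal (-ξ) 1).prod (gaussianReal (-ξ) 1)) (gaussianReal 0 1)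
    ((gaussianReal 0 1).prod (gaussianReal 0 1))
  have h3 := (MeasurePreserving.id ((gaussianReal (-ξ) 1).prod (gaussianReal 0 1))).prod
    (measurePreserving_prodProdProdComm (gaussianReal (-ξ) 1) (gaussianReal (-ξ) 1)
      (gaussianReal 0 1) (gaussianReal 0 1))
  exact h3.comp (h2.comp h1)

/-- The first coordinates for which only the last vertex lies to the left of the second axis. -/
def octantPPN : Set (ℝ × ℝ × ℝ) := Ioi 0 ×ˢ Ioi 0 ×ˢ Iio 0

/-- The first coordinates for which only the last vertex lies to the right of the second axis. -/
def octantNNP : Set (ℝ × ℝ × ℝ) := Iio 0 ×ˢ Iio 0 ×ˢ Ioi 0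

lemma measurableSet_octantPPN : MeasurableSet octantPPN :=
  measurableSet_Ioi.prod (measurableSet_Ioi.prod measurableSet_Iio)

lemma measurableSet_octantNNP : MeasurableSet octantNNP :=
  measurableSet_Iio.prod (measurableSet_Iio.prod measurableSet_Ioi)

lemma measurable_angle : Measurable fun p : ℝ × ℝ × ℝ ↦ angle p.1 p.2.1 p.2.2 := by
  unfold angle
  exact Real.measurable_arctan.comp (by fun_prop)

lemma abs_two_mul_angle_le (a b c : ℝ) : |2 * angle a b c| ≤ Real.pi := by
  have h1 := Real.arctan_lt_pi_div_two (a * b / (c * √(a ^ 2 + b ^ 2 + c ^ 2)))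
  have h2 := Real.neg_pi_div_two_lt_arctan (a * b / (c * √(a ^ 2 + b ^ 2 + c ^ 2)))
  rw [angle, abs_le]
  constructor <;> linarith

lemma arctan_quadrant_of_pos (a b : ℝ) {c : ℝ} (hc : 0 < c) :
    Real.arctan (a / c * (b / c) / √(1 + (a / c) ^ 2 + (b / c) ^ 2)) = angle a b c := by
  have h : 1 + (a / c) ^ 2 + (b / c) ^ 2 = (a ^ 2 + b ^ 2 + c ^ 2) / c ^ 2 := by
    field_simp; ring
  rw [angle, h, Real.sqrt_div' _ (sq_nonneg c), Real.sqrt_sq hc.le]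
  congr 1
  field_simp

lemma arctan_quadrant_of_neg (a b : ℝ) {c : ℝ} (hc : c < 0) :
    Real.arctan (a / c * (b / c) / √(1 + (a / c) ^ 2 + (b / c) ^ 2)) = -angle a b c := by
  have h := arctan_quadrant_of_pos (-a) (-b) (neg_pos.2 hc)
  simp only [neg_div_neg_eq] at h
  rw [h, angle, angle, ← Real.arctan_neg]
  congr 1
  simp only [neg_sq]
  rw [neg_mul_neg, neg_mul, div_neg]

/-- Given the first coordinates, the second axis meets the two edges at the last vertex in points
whose heights are normal, and the origin is captured when these have opposite signs. -/
lemma measureReal_section_lastOdd {a b c : ℝ}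
    (h : (a, b, c) ∈ octantPPN ∪ octantNNP) :
    ((gaussianReal 0 1).prod ((gaussianReal 0 1).prod (gaussianReal 0 1))).real
      {q | ((a, q.2.1), (b, q.2.2), (c, q.1)) ∈ lastOdd} =
      1 / 2 - Real.arctan (a / c * (b / c) / √(1 + (a / c) ^ 2 + (b / c) ^ 2)) / Real.pi := by
  have hc : c ≠ 0 := by
    rcases h with ⟨-, -, h⟩ | ⟨-, -, h⟩
    · exact ne_of_lt h
    · exact ne_of_gt h
  have h' : (0 < a ∧ 0 < b ∧ c < 0) ∨ (a < 0 ∧ b < 0 ∧ 0 < c) := h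
  rw [← measureReal_crossing]
  congr 1
  ext q
  simp only [lastOdd, mem_ofPred_eq, h', true_and, cross]
  have : (b * q.1 - q.2.2 * c) * (c * q.2.1 - q.1 * a) =
      c ^ 2 * ((b / c * q.1 - q.2.2) * (q.2.1 - a / c * q.1)) := by
    field_simp
  rw [this, mul_pos_iff_of_pos_left (by positivity)]

lemma tripleLaw_real_lastOdd (ξ : ℝ) :
    (tripleLaw ξ).real lastOdd = (2 * Real.pi)⁻¹ *
      ((∫ p in octantPPN, (Real.pi + 2 * angle p.1 p.2.1 p.2.2) ∂(firstLaw ξ)) +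
        ∫ p in octantNNP, (Real.pi - 2 * angle p.1 p.2.1 p.2.2) ∂(firstLaw ξ)) := by
  have hpi := Real.pi_pos
  have hj := measurePreserving_join ξ
  have hang := measurable_angle
  have hd : Disjoint octantPPN octantNNP := by
    rw [Set.disjoint_left]
    rintro p ⟨h1, -⟩ ⟨h2, -⟩
    exact lt_asymm (mem_Ioi.1 h1) (mem_Iio.1 h2)
  have hi1 : Integrable (fun p : ℝ × ℝ × ℝ ↦ Real.pi + 2 * angle p.1 p.2.1 p.2.2) (firstLaw ξ) :=
    (integrable_const _).add (Integrable.of_bound (hang.const_mul 2).aestronglyMeasurable Real.pi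
      (Filter.Eventually.of_forall fun p ↦ abs_two_mul_angle_le _ _ _))
  have hi2 : Integrable (fun p : ℝ × ℝ × ℝ ↦ Real.pi - 2 * angle p.1 p.2.1 p.2.2) (firstLaw ξ) :=
    (integrable_const _).sub (Integrable.of_bound (hang.const_mul 2).aestronglyMeasurable Real.pi
      (Filter.Eventually.of_forall fun p ↦ abs_two_mul_angle_le _ _ _))
  rw [← hj.map_eq, map_measureReal_apply hj.measurable measurableSet_lastOdd,
    real_prod_eq_integral _ _ (hj.measurable measurableSet_lastOdd)]
  rw [← integral_indicator measurableSet_octantPPN, ← integral_indicator measurableSet_octantNNP,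
    ← integral_add (hi1.indicator measurableSet_octantPPN) (hi2.indicator measurableSet_octantNNP),
    ← integral_const_mul]
  congr 1 with ⟨a, b, c⟩
  change ((gaussianReal 0 1).prod ((gaussianReal 0 1).prod (gaussianReal 0 1))).real
      {q | ((a, q.2.1), (b, q.2.2), (c, q.1)) ∈ lastOdd} = _
  by_cases h1 : (a, b, c) ∈ octantPPN
  · have h2 : (a, b, c) ∉ octantNNP := Set.disjoint_left.1 hd h1
    rw [measureReal_section_lastOdd (Or.inl h1), arctan_quadrant_of_neg a b h1.2.2,
      indicator_of_mem h1, indicator_of_notMem h2]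
    field_simp
    ring
  · by_cases h2 : (a, b, c) ∈ octantNNP
    · rw [measureReal_section_lastOdd (Or.inr h2), arctan_quadrant_of_pos a b h2.2.2,
        indicator_of_mem h2, indicator_of_notMem h1]
      field_simp
      ring
    · rw [indicator_of_notMem h1, indicator_of_notMem h2]
      have : {q : ℝ × ℝ × ℝ | ((a, q.2.1), (b, q.2.2), (c, q.1)) ∈ lastOdd} = ∅ := by
        ext q
        simp only [lastOdd, mem_ofPred_eq, mem_empty_iff_false, iff_false]
        rintro ⟨h | h, -⟩
        · exact h1 h
        · exact h2 h
      rw [this]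
      simp

/-! ### The octant integrals -/

lemma setIntegral_gaussianReal (m : ℝ) {s : Set ℝ} (hs : MeasurableSet s) (f : ℝ → ℝ) :
    ∫ x in s, f x ∂(gaussianReal m 1) =
      ∫ x in s, (√(2 * Real.pi))⁻¹ * Real.exp (-(x - m) ^ 2 / 2) * f x := by
  rw [gaussianReal_of_var_ne_zero _ one_ne_zero,
    setIntegral_withDensity_eq_setIntegral_toReal_smul (measurable_gaussianPDF _ _)
      (Filter.Eventually.of_forall fun _ ↦ gaussianPDF_lt_top) _ hs]
  simp only [toReal_gaussianPDF, gaussianPDFReal_eq, smul_eq_mul]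

lemma setIntegral_firstLaw (ξ : ℝ) {s t r : Set ℝ} (hs : MeasurableSet s) (ht : MeasurableSet t)
    (hr : MeasurableSet r) {f : ℝ × ℝ × ℝ → ℝ} (hf : Measurable f) {C : ℝ} (hC : ∀ p, |f p| ≤ C) :
    ∫ p in s ×ˢ t ×ˢ r, f p ∂(firstLaw ξ) =
      (√(2 * Real.pi))⁻¹ ^ 3 * ∫ a in s, ∫ b in t, ∫ c in r, weight ξ a b c * f (a, b, c) := by
  have hi : Integrable f (firstLaw ξ) :=
    Integrable.of_bound hf.aestronglyMeasurable C (Filter.Eventually.of_forall hC)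
  have hi2 : ∀ a, Integrable (fun q ↦ f (a, q))
      ((gaussianReal (-ξ) 1).prod (gaussianReal (-ξ) 1)) := fun a ↦
    Integrable.of_bound (hf.comp measurable_prodMk_left).aestronglyMeasurable C
      (Filter.Eventually.of_forall fun q ↦ hC _)
  rw [firstLaw, setIntegral_prod _ hi.integrableOn]
  simp only [setIntegral_prod _ (hi2 _).integrableOn]
  simp only [setIntegral_gaussianReal _ hs, setIntegral_gaussianReal _ ht,
    setIntegral_gaussianReal _ hr, ← integral_const_mul]
  congr 1 with a
  congr 1 with b
  congr 1 with c
  have : weight ξ a b c = Real.exp (-(a - -ξ) ^ 2 / 2) * Real.exp (-(b - -ξ) ^ 2 / 2) *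
      Real.exp (-(c - -ξ) ^ 2 / 2) := by
    rw [weight, ← Real.exp_add, ← Real.exp_add]
    congr 1
    ring
  rw [this]
  ring

lemma tripleLaw_real_cyclicTriples_eq_phi_add_psi (ξ : ℝ) :
    (tripleLaw ξ).real cyclicTriples =
      3 / (2 * Real.pi) ^ (5 / 2 : ℝ) * (phi ξ + psi ξ) := by
  have hang := measurable_angle
  have hb : ∀ a b c : ℝ, |Real.pi + 2 * angle a b c| ≤ 2 * Real.pi ∧
      |Real.pi - 2 * angle a b c| ≤ 2 * Real.pi := by
    intro a b c
    have h := abs_le.1 (abs_two_mul_angle_le a b c)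
    constructor <;> rw [abs_le] <;> constructor <;> linarith
  have hpow : (2 * Real.pi) ^ (5 / 2 : ℝ) = √(2 * Real.pi) ^ 5 := by
    rw [Real.sqrt_eq_rpow, ← Real.rpow_natCast, ← Real.rpow_mul (by positivity)]
    norm_num
  have hs : √(2 * Real.pi) ^ 2 = 2 * Real.pi := Real.sq_sqrt (by positivity)
  have hs0 : (0 : ℝ) < √(2 * Real.pi) := by positivity
  rw [tripleLaw_real_cyclicTriples_eq_lastOdd, tripleLaw_real_lastOdd, octantPPN, octantNNP,
    setIntegral_firstLaw ξ measurableSet_Ioi measurableSet_Ioi measurableSet_Iio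
      ((hang.const_mul 2).const_add _) (fun p ↦ (hb p.1 p.2.1 p.2.2).1),
    setIntegral_firstLaw ξ measurableSet_Iio measurableSet_Iio measurableSet_Ioi
      ((hang.const_mul 2).const_sub _) (fun p ↦ (hb p.1 p.2.1 p.2.2).2), hpow]
  simp only [phi, psi, phiIntegrand, psiIntegrand]
  generalize √(2 * Real.pi) = q at *
  rw [← hs]
  field_simp

lemma integrable_weight (ξ : ℝ) :
    Integrable fun p : ℝ × ℝ × ℝ ↦ weight ξ p.1 p.2.1 p.2.2 := by
  have h : Integrable fun x : ℝ ↦ Real.exp (-(x + ξ) ^ 2 / 2) :=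
    integrable_exp_neg_sq_div_two.comp_add_right ξ
  have h3 := h.mul_prod (h.mul_prod h)
  refine h3.congr (Filter.Eventually.of_forall fun p ↦ ?_)
  simp only [weight, ← Real.exp_add]
  congr 1
  ring

lemma integrable_phiIntegrand (ξ : ℝ) :
    Integrable fun p : ℝ × ℝ × ℝ ↦ phiIntegrand ξ p.1 p.2.1 p.2.2 := by
  refine (integrable_weight ξ).mul_bdd (c := 2 * Real.pi)
    ((measurable_angle.const_mul 2).const_add _).aestronglyMeasurable
    (Filter.Eventually.of_forall fun p ↦ ?_)
  have h := abs_le.1 (abs_two_mul_angle_le p.1 p.2.1 p.2.2)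
  rw [Real.norm_eq_abs, abs_le]
  constructor <;> linarith

lemma integrable_psiIntegrand (ξ : ℝ) :
    Integrable fun p : ℝ × ℝ × ℝ ↦ psiIntegrand ξ p.1 p.2.1 p.2.2 := by
  refine (integrable_weight ξ).mul_bdd (c := 2 * Real.pi)
    ((measurable_angle.const_mul 2).const_sub _).aestronglyMeasurable
    (Filter.Eventually.of_forall fun p ↦ ?_)
  have h := abs_le.1 (abs_two_mul_angle_le p.1 p.2.1 p.2.2)
  rw [Real.norm_eq_abs, abs_le]
  constructor <;> linarith

/-! ### Numerical values -/

lemma tripleLaw_real_zero : (tripleLaw 0).real cyclicTriples = 1 / 4 := by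
  simp [tripleLaw_real_cyclicTriples, sideDist, gaussInt_zero]

/-- Here and below `m` and `M` enclose the mean of `gaussInt (sideDist ξ) ^ 2`, found by evaluating
`approxMean`, in an interval short enough to decide the sixth decimal. -/
lemma tripleLaw_real_half :
    (tripleLaw (1 / 2)).real cyclicTriples ∈ Ico (0.197171 : ℝ) 0.197172 := by
  have h := tripleLaw_real_mem_Ico (ξ := 1 / 2) (by norm_num [abs_of_pos]) (1 / 8) (by norm_num)
    (m := 1106446549 / 10 ^ 10) (M := 1106446553 / 10 ^ 10) (l := 197171 / 10 ^ 6)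
    (u := 197172 / 10 ^ 6) (by decide +kernel) (by decide +kernel) (by norm_num) (by norm_num)
    (by norm_num) (by norm_num)
  convert h using 2 <;> norm_num

lemma tripleLaw_real_one :
    (tripleLaw 1).real cyclicTriples ∈ Ico (0.098289 : ℝ) 0.098290 := by
  have h := tripleLaw_real_mem_Ico (ξ := 1) (by norm_num) (1 / 2) (by norm_num)
    (m := 3177418318 / 10 ^ 10) (M := 3177418323 / 10 ^ 10) (l := 98289 / 10 ^ 6)
    (u := 98290 / 10 ^ 6) (by decide +kernel) (by decide +kernel) (by norm_num) (by norm_num)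
    (by norm_num) (by norm_num)
  convert h using 2 <;> norm_num

lemma tripleLaw_real_three_halves :
    (tripleLaw (3 / 2)).real cyclicTriples ∈ Ico (0.032455 : ℝ) 0.032456 := by
  have h := tripleLaw_real_mem_Ico (ξ := 3 / 2) (by norm_num [abs_of_pos]) (9 / 8) (by norm_num)
    (m := 4556249512 / 10 ^ 10) (M := 4556249516 / 10 ^ 10) (l := 32455 / 10 ^ 6)
    (u := 32456 / 10 ^ 6) (by decide +kernel) (by decide +kernel) (by norm_num) (by norm_num)
    (by norm_num) (by norm_num)
  convert h using 2 <;> norm_num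

lemma tripleLaw_real_two :
    (tripleLaw 2).real cyclicTriples ∈ Ico (0.007626 : ℝ) 0.007627 := by
  have h := tripleLaw_real_mem_Ico (ξ := 2) (by norm_num) 2 (by norm_num)
    (m := 5076248409 / 10 ^ 10) (M := 5076248413 / 10 ^ 10) (l := 7626 / 10 ^ 6)
    (u := 7627 / 10 ^ 6) (by decide +kernel) (by decide +kernel) (by norm_num) (by norm_num)
    (by norm_num) (by norm_num)
  convert h using 2 <;> norm_num

end GaussianCapture

theorem mainTheorem1 {Ω : Type*} [MeasurableSpace Ω] (μ : Measure Ω) [IsProbabilityMeasure μ]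
    (A B C : Ω → GaussianCapture.Plane)
    (hA : HasLaw A (stdGaussian GaussianCapture.Plane) μ)
    (hB : HasLaw B (stdGaussian GaussianCapture.Plane) μ)
    (hC : HasLaw C (stdGaussian GaussianCapture.Plane) μ)
    (hABC : iIndepFun ![A, B, C] μ) :
    -- the integrands are integrable over the octants in question
    (∀ ξ : ℝ,
      IntegrableOn (fun x : ℝ × ℝ × ℝ => GaussianCapture.phiIntegrand ξ x.1 x.2.1 x.2.2)
        (Ioi 0 ×ˢ Ioi 0 ×ˢ Iio 0) ∧
      IntegrableOn (fun x : ℝ × ℝ × ℝ => GaussianCapture.psiIntegrand ξ x.1 x.2.1 x.2.2)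
        (Iio 0 ×ˢ Iio 0 ×ˢ Ioi 0)) ∧
    -- reduction of a general location to one on the first axis
    (∀ ξ η : ℝ,
      GaussianCapture.captureProb μ A B C ξ η =
        GaussianCapture.captureProb μ A B C (Real.sqrt (ξ ^ 2 + η ^ 2)) 0) ∧
    -- the capture probability of a location on the first axis
    (∀ ξ : ℝ,
      GaussianCapture.captureProb μ A B C ξ 0 =
        3 / (2 * Real.pi) ^ (5 / 2 : ℝ) * (GaussianCapture.phi ξ + GaussianCapture.psi ξ)) ∧
    -- its values at `0`, `1/2`, `1`, `3/2`, `2`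
    GaussianCapture.captureProb μ A B C 0 0 = 1 / 4 ∧
    GaussianCapture.captureProb μ A B C (1 / 2) 0 ∈ Ico (0.197171 : ℝ) 0.197172 ∧
    GaussianCapture.captureProb μ A B C 1 0 ∈ Ico (0.098289 : ℝ) 0.098290 ∧
    GaussianCapture.captureProb μ A B C (3 / 2) 0 ∈ Ico (0.032455 : ℝ) 0.032456 ∧
    GaussianCapture.captureProb μ A B C 2 0 ∈ Ico (0.007626 : ℝ) 0.007627 := by
  have key := GaussianCapture.captureProb_eq_tripleLaw hA hB hC hABC
  refine ⟨fun ξ ↦ ⟨(GaussianCapture.integrable_phiIntegrand ξ).integrableOn,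
      (GaussianCapture.integrable_psiIntegrand ξ).integrableOn⟩,
    GaussianCapture.captureProb_eq_captureProb_norm hA hB hC hABC, fun ξ ↦ ?_, ?_, ?_, ?_, ?_, ?_⟩
  · rw [key, GaussianCapture.tripleLaw_real_cyclicTriples_eq_phi_add_psi]
  · rw [key, GaussianCapture.tripleLaw_real_zero]
  · rw [key]; exact GaussianCapture.tripleLaw_real_half
  · rw [key]; exact GaussianCapture.tripleLaw_real_one
  · rw [key]; exact GaussianCapture.tripleLaw_real_three_halves
  · rw [key]; exact GaussianCapture.tripleLaw_real_two
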